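/- Consider the class of nonlinear wave equations \[ u_{tt}=f(x,u_x)\,u_{xx}+g(x,u_x),\qquad (f_{u_x},g_{u_xu_x})\ne(0,0), \] where the arbitrary elements $f,g$ are smooth functions of $(x,u_x)$ on an open set and the pair $(f_{u_x},g_{u_xu_x})$ does not vanish identically (on any nonempty open part of that set). Let $G^\sim$ be its (usual) equivalence pseudogroup: the local diffeomorphisms $\Phi$ of the space of $(t,x,u,u_t,u_x,f,g)$ that project to the space of $(t,x,u)$ and to the space of $(t,x,u,u_t,u_x)$, the latter projection being the first prolongation of the former, and such that (locally) for all arbitrary elements $\theta=(f,g)$ of the class the image $\Phi\theta$ again belongs to the class and the projection of $\Phi$ to $(t,x,u)$ maps the equation given by $\theta$ to the equation given by $\Phi\theta$. A continuous equivalence transformation is (locally) a finite composition of transformations belonging to smooth local one-parameter groups contained in $G^\sim$. A complete list of discrete equivalence transformations of this class that are independent up to composing with each other and with continuous equivalence transformations is exhausted by the three transformations \begin{align*} R_1&\colon\ (t,x,u,u_x,f,g)\mapsto(-t,x,u,u_x,f,g),\\ R_2&\colon\ (t,x,u,u_x,f,g)\mapsto(t,-x,u,-u_x,f,g),\\ R_3&\colon\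 (t,x,u,u_x,f,g)\mapsto(t,x,-u,-u_x,f,-g) \end{align*} (with the induced action $u_t\mapsto-u_t$, $u_t\mapsto u_t$, $u_t\mapsto-u_t$, respectively). That is, $R_1,R_2,R_3$ belong to $G^\sim$, and for every $\Phi\in G^\sim$ with connected domain there is $(\varepsilon_1,\varepsilon_2,\varepsilon_3)\in\{0,1\}^3$ such that near every point of its domain $\Phi$ coincides with $R_1^{\varepsilon_1}\circ R_2^{\varepsilon_2}\circ R_3^{\varepsilon_3}\circ\Psi$ for some continuous equivalence transformation $\Psi$; moreover, near no point of its domain does $\Phi$ admit such a representation with another triple of exponents. -/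

import Mathlib

open Set Filter Topology
open scoped ContDiff

namespace NonlinearWave

/-- The space of the variables `(t, x, u)`; coordinates `((t, x, u))`. -/
abbrev J0 : Type := ℝ × ℝ × ℝ

/-- The first-order jet space; coordinates `((t, x, u), (u_t, u_x))`. -/
abbrev J1 : Type := J0 × ℝ × ℝ

/-- The second-order jet space; coordinates `(((t, x, u), (u_t, u_x)), (u_tt, u_tx, u_xx))`. -/
abbrev J2 : Type := J1 × ℝ × ℝ × ℝ

/-- The space extended by the arbitrary elements; coordinates
`(((t, x, u), (u_t, u_x)), (f, g))`. -/
abbrev Ext : Type := J1 × ℝ × ℝ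

/-- The pair `(x, u_x)`, on which the arbitrary elements depend. -/
def J1.args (j : J1) : ℝ × ℝ := (j.1.2.1, j.2.2)

/-- A pair of functions `f`, `g` of `(x, u_x)` considered on a domain. Nothing is required of
the values outside `dom`. -/
structure Elements where
  dom : Set (ℝ × ℝ)
  f : ℝ × ℝ → ℝ
  g : ℝ × ℝ → ℝ

/-- The arbitrary elements of the class: smooth functions `f`, `g` of `(x, u_x)` on an open domain
such that the pair `(f_{u_x}, g_{u_x u_x})` does not vanish identically, on that domain or on any
nonempty open part of it. -/
structure Elements.Admissible (θ : Elements) : Prop where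
  isOpen_dom : IsOpen θ.dom
  contDiffOn_f : ContDiffOn ℝ ∞ θ.f θ.dom
  contDiffOn_g : ContDiffOn ℝ ∞ θ.g θ.dom
  nonlinear : ∀ V : Set (ℝ × ℝ), IsOpen V → V.Nonempty → V ⊆ θ.dom →
    ∃ a ∈ V, (deriv (fun p => θ.f (a.1, p)) a.2, iteratedDeriv 2 (fun p => θ.g (a.1, p)) a.2)
      ≠ ((0, 0) : ℝ × ℝ)

/-- The graph of `θ` in the extended space. -/
def Elements.graph (θ : Elements) : Set Ext :=
  {z | z.1.args ∈ θ.dom ∧ z.2 = (θ.f z.1.args, θ.g z.1.args)}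

/-- The equation `u_tt = f(x, u_x) u_xx + g(x, u_x)` as a subset of the second-order jet space. -/
def Elements.equation (θ : Elements) : Set J2 :=
  {y | y.1.args ∈ θ.dom ∧ y.2.1 = θ.f y.1.args * y.2.2.2 + θ.g y.1.args}

/-- `j'` is the value at `j` of the first prolongation of the point transformation
`P = (T, X, U)`: the chain rules `D_t U = u'_t D_t T + u'_x D_t X` and
`D_x U = u'_t D_x T + u'_x D_x X` hold, `D_t` and `D_x` being the total derivatives. -/
def IsFirstProlongationAt (P : J0 → J0) (j j' : J1) : Prop :=
  j'.1 = P j.1 ∧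
  (let a : J0 := fderiv ℝ P j.1 (1, 0, j.2.1)
   a.2.2 = j'.2.1 * a.1 + j'.2.2 * a.2.1) ∧
  (let b : J0 := fderiv ℝ P j.1 (0, 1, j.2.2)
   b.2.2 = j'.2.1 * b.1 + j'.2.2 * b.2.1)

/-- Let `Q = (T, X, U, U^t, U^x)` be a first prolongation. If `q = (u_tt, u_tx, u_xx)` are the
second derivatives over the jet `j`, then `q' = (u'_tt, u'_tx, u'_xx)` are the transformed second
derivatives, over the jet `Q j`: with `D` either of the two total derivatives,
`D U^t = u'_tt D T + u'_tx D X` and `D U^x = u'_tx D T + u'_xx D X`. -/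
def IsSecondProlongationAt (Q : J1 → J1) (j : J1) (q q' : ℝ × ℝ × ℝ) : Prop :=
  (let a : J1 := fderiv ℝ Q j ((1, 0, j.2.1), (q.1, q.2.1))
   a.2.1 = q'.1 * a.1.1 + q'.2.1 * a.1.2.1 ∧ a.2.2 = q'.2.1 * a.1.1 + q'.2.2 * a.1.2.1) ∧
  (let b : J1 := fderiv ℝ Q j ((0, 1, j.2.2), (q.2.1, q.2.2))
   b.2.1 = q'.1 * b.1.1 + q'.2.1 * b.1.2.1 ∧ b.2.2 = q'.2.1 * b.1.1 + q'.2.2 * b.1.2.1)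

/-- Near the jet `j`, the second prolongation of the point transformation with first prolongation
`Q` maps the equation with arbitrary elements `θ` to the one with arbitrary elements `θ'`. -/
def MapsEquationNear (Q : J1 → J1) (θ θ' : Elements) (j : J1) : Prop :=
  ∀ᶠ k in 𝓝 j, ∀ q : ℝ × ℝ × ℝ, ∃ q' : ℝ × ℝ × ℝ,
    IsSecondProlongationAt Q k q q' ∧ ((k, q) ∈ θ.equation ↔ (Q k, q') ∈ θ'.equation)

/-- The equivalence pseudogroup of the class of equations `u_tt = f(x, u_x) u_xx + g(x, u_x)`.
Its elements are the local diffeomorphisms `Φ` of the extended space that project to `(t, x, u)`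
(as `P`) and to the first-order jet space (as the first prolongation `Q` of `P`), such that the
image `θ'` of any admissible `θ` is admissible and `P` maps the equation given by `θ` to the one
given by `θ'`. As `Φ` and `θ` are only locally defined, the last condition is imposed near each
point of the part of the graph of `θ` that lies in the domain of `Φ`. -/
structure IsEquivalenceTransformation (Φ : OpenPartialHomeomorph Ext Ext) : Prop where
  smooth : ContDiffOn ℝ ∞ Φ Φ.source
  smooth_symm : ContDiffOn ℝ ∞ Φ.symm Φ.target
  preserves : ∃ (P : J0 → J0) (Q : J1 → J1),
    (∀ z ∈ Φ.source, (Φ z).1.1 = P z.1.1) ∧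
    (∀ z ∈ Φ.source, (Φ z).1 = Q z.1) ∧
    (∀ z ∈ Φ.source, IsFirstProlongationAt P z.1 (Q z.1)) ∧
    ∀ θ : Elements, θ.Admissible → ∀ z ∈ Φ.source, z ∈ θ.graph →
      ∃ θ' : Elements, θ'.Admissible ∧
        (∀ᶠ w in 𝓝 z, w ∈ θ.graph ↔ Φ w ∈ θ'.graph) ∧
        MapsEquationNear Q θ θ' z.1

/-- A smooth local one-parameter group of transformations of the extended space, with transformation
`map s` of parameter `s` being defined at `z` if `(s, z) ∈ dom`. -/
structure LocalOneParameterGroup where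
  dom : Set (ℝ × Ext)
  map : ℝ → Ext → Ext
  isOpen_dom : IsOpen dom
  smooth : ContDiffOn ℝ ∞ (fun p : ℝ × Ext => map p.1 p.2) dom
  zero_mem : ∀ s z, (s, z) ∈ dom → (0, z) ∈ dom
  interval : ∀ z, {s : ℝ | (s, z) ∈ dom}.OrdConnected
  map_zero : ∀ z, (0, z) ∈ dom → map 0 z = z
  neg_mem : ∀ s z, (s, z) ∈ dom → (-s, map s z) ∈ dom
  map_add : ∀ r s z, (r, z) ∈ dom → (s, map r z) ∈ dom → (s + r, z) ∈ dom →
    map s (map r z) = map (s + r) z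

/-- All transformations of the one-parameter group are (locally) equivalence transformations. -/
def LocalOneParameterGroup.InEquivalenceGroup (γ : LocalOneParameterGroup) : Prop :=
  ∀ s z, (s, z) ∈ γ.dom → ∃ Φ : OpenPartialHomeomorph Ext Ext,
    IsEquivalenceTransformation Φ ∧ z ∈ Φ.source ∧ γ.map s =ᶠ[𝓝 z] Φ

/-- `IsContinuousEquivalence Ψ z`: near `z`, the map `Ψ` is a continuous equivalence
transformation, i.e. a composition of finitely many transformations that belong to local
one-parameter groups of equivalence transformations. -/
inductive IsContinuousEquivalence : (Ext → Ext) → Ext → Prop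
  | of_group (γ : LocalOneParameterGroup) (hγ : γ.InEquivalenceGroup) (s : ℝ) (z : Ext)
      (hz : (s, z) ∈ γ.dom) : IsContinuousEquivalence (γ.map s) z
  | comp (Ψ₁ Ψ₂ : Ext → Ext) (z : Ext) (h₁ : IsContinuousEquivalence Ψ₁ z)
      (h₂ : IsContinuousEquivalence Ψ₂ (Ψ₁ z)) : IsContinuousEquivalence (Ψ₂ ∘ Ψ₁) z

/-- The reflection `t ↦ -t` (so `u_t ↦ -u_t`). -/
def reflectT : Ext ≃ₜ Ext where
  toFun z := (((-z.1.1.1, z.1.1.2.1, z.1.1.2.2), (-z.1.2.1, z.1.2.2)), (z.2.1, z.2.2))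
  invFun z := (((-z.1.1.1, z.1.1.2.1, z.1.1.2.2), (-z.1.2.1, z.1.2.2)), (z.2.1, z.2.2))
  left_inv z := by simp
  right_inv z := by simp
  continuous_toFun := by fun_prop
  continuous_invFun := by fun_prop

/-- The reflection `(x, u_x) ↦ (-x, -u_x)`. -/
def reflectX : Ext ≃ₜ Ext where
  toFun z := (((z.1.1.1, -z.1.1.2.1, z.1.1.2.2), (z.1.2.1, -z.1.2.2)), (z.2.1, z.2.2))
  invFun z := (((z.1.1.1, -z.1.1.2.1, z.1.1.2.2), (z.1.2.1, -z.1.2.2)), (z.2.1, z.2.2))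
  left_inv z := by simp
  right_inv z := by simp
  continuous_toFun := by fun_prop
  continuous_invFun := by fun_prop

/-- The reflection `(u, u_x, g) ↦ (-u, -u_x, -g)` (so `u_t ↦ -u_t`). -/
def reflectU : Ext ≃ₜ Ext where
  toFun z := (((z.1.1.1, z.1.1.2.1, -z.1.1.2.2), (-z.1.2.1, -z.1.2.2)), (z.2.1, -z.2.2))
  invFun z := (((z.1.1.1, z.1.1.2.1, -z.1.1.2.2), (-z.1.2.1, -z.1.2.2)), (z.2.1, -z.2.2))
  left_inv z := by simp
  right_inv z := by simp
  continuous_toFun := by fun_prop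
  continuous_invFun := by fun_prop

/-- The composition of those of the three reflections whose exponent is `1`. -/
def reflection (ε : Fin 3 → Fin 2) : Ext → Ext :=
  reflectT^[(ε 0 : ℕ)] ∘ reflectX^[(ε 1 : ℕ)] ∘ reflectU^[(ε 2 : ℕ)]

/-- Near `z`, the map `Φ` is the composition of a continuous equivalence transformation and the
product of reflections with exponents `ε`. -/
def DecomposesAt (Φ : Ext → Ext) (ε : Fin 3 → Fin 2) (z : Ext) : Prop :=
  ∃ Ψ : Ext → Ext, IsContinuousEquivalence Ψ z ∧ Φ =ᶠ[𝓝 z] reflection ε ∘ Ψ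

end NonlinearWave

/-!
The theorem rests on the explicit form of the equivalence transformations. Let `Φ` be one, with
projections `P = (T, X, U)` to the space of `(t, x, u)` and `Q = (P, U^t, U^x)` to the jet space.

At a single jet, the transformed Hessian depends affinely on the old one, with linear part
`l M⁻¹ H M⁻ᵀ`, where `M` is the matrix of total derivatives of `T` and `X` and `l ≠ 0`. Mapping the
hyperplane `u_tt = f u_xx + g` to one of the same kind therefore means that `diag (1, -f')` and
`Mᵀ diag (1, -f) M` are proportional (`coefficient_relations`). As `f` is arbitrary,
`D_t T · D_t X = 0 = D_x T · D_x X`. If `D_t T = D_x X = 0`, then `f'` is inversely proportional to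
`f`, while it cannot depend on `u_x`; this is impossible (`Preserves.totalT_x_eq_zero`). So
`T = T (t)`, `X = X (x)` and `f' = (X_x / T_t) ^ 2 f`. Here `f'` is a function of the new `(x, u_x)`
only, and differentiating along `t`, `u` and `u_x`, with two different values of `f` over the same
jet, gives `T_tt = 0` and shows that `U^x` depends on `(x, u_x)` only (`Preserves.second_order`).
Hence `U = c₂ u + ψ (x) + χ (t)`, and the transformation rule for `g` forces `χ` to be quadratic
(`Preserves.exists_normalForm`). It suffices to use test functions `f` affine in `u_x` and constant
`g`. Conversely, every transformation of this form that is defined globally is an equivalence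
transformation (`Coeffs.IsGlobal.isEquivalenceTransformation`).

The numbers `T_t`, `X_x`, `U_u` are nonzero and multiplicative under composition. Along a
one-parameter group they are continuous and start from `1`, so they are positive on all continuous
equivalence transformations (`IsContinuousEquivalence.hasScales_pos`), while their signs separate
the eight products of reflections; on a connected domain the signs are constant. This gives
uniqueness of the exponents and shows which exponents to take.

For existence it remains to write a transformation with `T_t, X_x, U_u > 0` as a composition of
members of one-parameter groups (`exists_isContinuousEquivalence`). Scalings, translations of `t`
and additions of functions to `u` are evident groups. For the action `φ` on `x`, a translation is
split off so that the remaining germ moves its base point `x₀`. Such a germ is the time-`s` map of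
the flow `x ↦ h⁻¹ (h x + s)`, where `h` is a diffeomorphism of the line with `h' = φ'` near `x₀` and
`h' = 1` near `φ x₀` (`exists_flow`).
-/

namespace NonlinearWave

noncomputable section

/-! ### Explicit transformations -/

theorem fderiv_eq_of_hasDerivAt_line {E F : Type*} [NormedAddCommGroup E] [NormedSpace ℝ E]
    [NormedAddCommGroup F] [NormedSpace ℝ F] {f : E → F} {x v : E} {d : F}
    (hf : DifferentiableAt ℝ f x) (h : HasDerivAt (fun s : ℝ => f (x + s • v)) d 0) :
    fderiv ℝ f x v = d :=
  hf.hasFDerivAt.hasLineDerivAt v |>.unique h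

theorem HasDerivAt.prod_fst {E F : Type*} [NormedAddCommGroup E] [NormedSpace ℝ E]
    [NormedAddCommGroup F] [NormedSpace ℝ F] {f : ℝ → E × F} {x : ℝ} {d : E × F}
    (h : HasDerivAt f d x) : HasDerivAt (fun s => (f s).1) d.1 x :=
  (ContinuousLinearMap.fst ℝ E F).hasFDerivAt.comp_hasDerivAt x h

theorem HasDerivAt.prod_snd {E F : Type*} [NormedAddCommGroup E] [NormedSpace ℝ E]
    [NormedAddCommGroup F] [NormedSpace ℝ F] {f : ℝ → E × F} {x : ℝ} {d : E × F}
    (h : HasDerivAt f d x) : HasDerivAt (fun s => (f s).2) d.2 x :=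
  (ContinuousLinearMap.snd ℝ E F).hasFDerivAt.comp_hasDerivAt x h

/-- The coefficients of the transformation
`t ↦ c₁ t + c₀`, `x ↦ φ x`, `u ↦ c₂ u + c₄ t ^ 2 + c₃ t + ψ x`. The functions `φ₁`, `φ₂` and
`ψ₁`, `ψ₂` stand for the first two derivatives of `φ` and `ψ`; they are part of the data so that
explicit formulas for them can be used. -/
structure Coeffs where
  (c₀ c₁ c₂ c₃ c₄ : ℝ)
  (φ φ₁ φ₂ ψ ψ₁ ψ₂ : ℝ → ℝ)

namespace Coeffs

/-- The point transformation with the given coefficients. -/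
def point (p : Coeffs) (y : J0) : J0 :=
  (p.c₁ * y.1 + p.c₀, p.φ y.2.1, p.c₂ * y.2.2 + p.c₄ * y.1 ^ 2 + p.c₃ * y.1 + p.ψ y.2.1)

/-- The action on the arguments `(x, u_x)` of the arbitrary elements. -/
def args (p : Coeffs) (a : ℝ × ℝ) : ℝ × ℝ :=
  (p.φ a.1, (p.c₂ * a.2 + p.ψ₁ a.1) / p.φ₁ a.1)

/-- The first prolongation of the point transformation. -/
def jet (p : Coeffs) (k : J1) : J1 :=
  (p.point k.1, ((p.c₂ * k.2.1 + 2 * p.c₄ * k.1.1 + p.c₃) / p.c₁, (p.args k.args).2))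

/-- The action on the values of the arbitrary elements at `a = (x, u_x)`. -/
def val (p : Coeffs) (a : ℝ × ℝ) (w : ℝ × ℝ) : ℝ × ℝ :=
  (p.φ₁ a.1 ^ 2 / p.c₁ ^ 2 * w.1,
    (p.c₂ * w.2 + ((p.c₂ * a.2 + p.ψ₁ a.1) * p.φ₂ a.1 / p.φ₁ a.1 - p.ψ₂ a.1) * w.1 + 2 * p.c₄)
      / p.c₁ ^ 2)

/-- The equivalence transformation with the given coefficients. -/
def ext (p : Coeffs) (z : Ext) : Ext := (p.jet z.1, p.val z.1.args z.2)

/-- The coefficients define a transformation of the whole extended space, `χ` being the inverse of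
`φ`. -/
structure IsGlobal (p : Coeffs) (χ : ℝ → ℝ) : Prop where
  c₁_ne : p.c₁ ≠ 0
  c₂_ne : p.c₂ ≠ 0
  φ₁_ne : ∀ x, p.φ₁ x ≠ 0
  left_inv : ∀ x, χ (p.φ x) = x
  right_inv : ∀ x, p.φ (χ x) = x
  hasDerivAt_φ : ∀ x, HasDerivAt p.φ (p.φ₁ x) x
  hasDerivAt_φ₁ : ∀ x, HasDerivAt p.φ₁ (p.φ₂ x) x
  hasDerivAt_ψ : ∀ x, HasDerivAt p.ψ (p.ψ₁ x) x
  hasDerivAt_ψ₁ : ∀ x, HasDerivAt p.ψ₁ (p.ψ₂ x) x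
  smooth_φ₂ : ContDiff ℝ ∞ p.φ₂
  smooth_ψ₂ : ContDiff ℝ ∞ p.ψ₂
  smooth_χ : ContDiff ℝ ∞ χ

theorem contDiff_of_hasDerivAt {f f' : ℝ → ℝ} (h : ∀ x, HasDerivAt f (f' x) x)
    (h' : ContDiff ℝ ∞ f') : ContDiff ℝ ∞ f := by
  rw [contDiff_infty_iff_deriv]
  refine ⟨fun x => (h x).differentiableAt, ?_⟩
  rwa [show deriv f = f' from funext fun x => (h x).deriv]

/-- The action on `(x, u_x)` is inverted explicitly, given an inverse `χ` of `φ`. -/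
def argsInv (p : Coeffs) (χ : ℝ → ℝ) (b : ℝ × ℝ) : ℝ × ℝ :=
  (χ b.1, (p.φ₁ (χ b.1) * b.2 - p.ψ₁ (χ b.1)) / p.c₂)

/-- The inverse of `Coeffs.ext`, given an inverse `χ` of `φ`. -/
def extInv (p : Coeffs) (χ : ℝ → ℝ) (z : Ext) : Ext :=
  let t := (z.1.1.1 - p.c₀) / p.c₁
  let a := p.argsInv χ z.1.args
  let f := p.c₁ ^ 2 / p.φ₁ a.1 ^ 2 * z.2.1
  (((t, a.1, (z.1.1.2.2 - p.c₄ * t ^ 2 - p.c₃ * t - p.ψ a.1) / p.c₂),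
    ((p.c₁ * z.1.2.1 - 2 * p.c₄ * t - p.c₃) / p.c₂, a.2)),
   (f, (p.c₁ ^ 2 * z.2.2 - 2 * p.c₄
      - ((p.c₂ * a.2 + p.ψ₁ a.1) * p.φ₂ a.1 / p.φ₁ a.1 - p.ψ₂ a.1) * f) / p.c₂))

/-- Joint smoothness in the parameter and the point for a family of transformations. -/
theorem contDiff_ext_family {p : ℝ → Coeffs}
    (h₀ : ContDiff ℝ ∞ fun s => (p s).c₀) (h₁ : ContDiff ℝ ∞ fun s => (p s).c₁)
    (h₂ : ContDiff ℝ ∞ fun s => (p s).c₂) (h₃ : ContDiff ℝ ∞ fun s => (p s).c₃)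
    (h₄ : ContDiff ℝ ∞ fun s => (p s).c₄)
    (hφ : ContDiff ℝ ∞ fun a : ℝ × ℝ => (p a.1).φ a.2)
    (hφ₁ : ContDiff ℝ ∞ fun a : ℝ × ℝ => (p a.1).φ₁ a.2)
    (hφ₂ : ContDiff ℝ ∞ fun a : ℝ × ℝ => (p a.1).φ₂ a.2)
    (hψ : ContDiff ℝ ∞ fun a : ℝ × ℝ => (p a.1).ψ a.2)
    (hψ₁ : ContDiff ℝ ∞ fun a : ℝ × ℝ => (p a.1).ψ₁ a.2)
    (hψ₂ : ContDiff ℝ ∞ fun a : ℝ × ℝ => (p a.1).ψ₂ a.2)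
    (hc₁ : ∀ s, (p s).c₁ ≠ 0) (hφ₁0 : ∀ s x, (p s).φ₁ x ≠ 0) :
    ContDiff ℝ ∞ fun q : ℝ × Ext => (p q.1).ext q.2 := by
  have hx : ContDiff ℝ ∞ fun q : ℝ × Ext => (q.1, q.2.1.1.2.1) := by fun_prop
  replace h₀ := h₀.comp (contDiff_fst (E := ℝ) (F := Ext))
  replace h₁ := h₁.comp (contDiff_fst (E := ℝ) (F := Ext))
  replace h₂ := h₂.comp (contDiff_fst (E := ℝ) (F := Ext))
  replace h₃ := h₃.comp (contDiff_fst (E := ℝ) (F := Ext))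
  replace h₄ := h₄.comp (contDiff_fst (E := ℝ) (F := Ext))
  replace hφ := hφ.comp hx
  replace hφ₁ := hφ₁.comp hx
  replace hφ₂ := hφ₂.comp hx
  replace hψ := hψ.comp hx
  replace hψ₁ := hψ₁.comp hx
  replace hψ₂ := hψ₂.comp hx
  simp only [Function.comp_def] at *
  have e₁ : ∀ q : ℝ × Ext, (p q.1).c₁ ^ 2 ≠ 0 := fun q => pow_ne_zero 2 (hc₁ _)
  unfold ext jet point val args J1.args
  fun_prop (disch := first | exact fun q => hc₁ _ | exact fun q => hφ₁0 _ _ | exact e₁)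

variable {p : Coeffs} {χ : ℝ → ℝ}

theorem IsGlobal.smooth_φ₁ (h : p.IsGlobal χ) : ContDiff ℝ ∞ p.φ₁ :=
  contDiff_of_hasDerivAt h.hasDerivAt_φ₁ h.smooth_φ₂

theorem IsGlobal.smooth_φ (h : p.IsGlobal χ) : ContDiff ℝ ∞ p.φ :=
  contDiff_of_hasDerivAt h.hasDerivAt_φ h.smooth_φ₁

theorem IsGlobal.smooth_ψ₁ (h : p.IsGlobal χ) : ContDiff ℝ ∞ p.ψ₁ :=
  contDiff_of_hasDerivAt h.hasDerivAt_ψ₁ h.smooth_ψ₂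

theorem IsGlobal.smooth_ψ (h : p.IsGlobal χ) : ContDiff ℝ ∞ p.ψ :=
  contDiff_of_hasDerivAt h.hasDerivAt_ψ h.smooth_ψ₁

theorem IsGlobal.contDiff_ext (h : p.IsGlobal χ) : ContDiff ℝ ∞ p.ext := by
  have := contDiff_ext_family (p := fun _ => p) contDiff_const contDiff_const contDiff_const
    contDiff_const contDiff_const (h.smooth_φ.comp contDiff_snd) (h.smooth_φ₁.comp contDiff_snd)
    (h.smooth_φ₂.comp contDiff_snd) (h.smooth_ψ.comp contDiff_snd) (h.smooth_ψ₁.comp contDiff_snd)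
    (h.smooth_ψ₂.comp contDiff_snd) (fun _ => h.c₁_ne) (fun _ => h.φ₁_ne)
  exact this.comp (contDiff_const (c := (0 : ℝ)).prodMk contDiff_id)

theorem IsGlobal.contDiff_argsInv (h : p.IsGlobal χ) : ContDiff ℝ ∞ (p.argsInv χ) := by
  have h1 := h.smooth_χ
  have h2 := h.smooth_φ₁
  have h3 := h.smooth_ψ₁
  unfold argsInv
  fun_prop

theorem IsGlobal.contDiff_extInv (h : p.IsGlobal χ) : ContDiff ℝ ∞ (p.extInv χ) := by
  have h1 := h.contDiff_argsInv.comp (show ContDiff ℝ ∞ fun z : Ext => z.1.args by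
    unfold J1.args; fun_prop)
  have h2 := h.smooth_φ₁
  have h3 := h.smooth_ψ₁
  have h4 := h.smooth_φ₂
  have h5 := h.smooth_ψ₂
  have h6 := h.smooth_ψ
  have h7 := h.smooth_χ
  simp only [Function.comp_def] at h1
  have e : ∀ z : Ext, p.φ₁ (p.argsInv χ z.1.args).1 ≠ 0 := fun z => h.φ₁_ne _
  have e2 : ∀ z : Ext, p.φ₁ (p.argsInv χ z.1.args).1 ^ 2 ≠ 0 := fun z => pow_ne_zero 2 (e z)
  unfold extInv
  dsimp only
  fun_prop (disch := first | exact e | exact e2)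

theorem IsGlobal.argsInv_args (h : p.IsGlobal χ) (a : ℝ × ℝ) : p.argsInv χ (p.args a) = a := by
  have h1 := h.c₂_ne
  have h2 := h.φ₁_ne a.1
  ext
  · simp [argsInv, args, h.left_inv]
  · simp only [argsInv, args, h.left_inv]
    field_simp
    ring

theorem IsGlobal.args_argsInv (h : p.IsGlobal χ) (b : ℝ × ℝ) : p.args (p.argsInv χ b) = b := by
  have h1 := h.c₂_ne
  have h2 := h.φ₁_ne (χ b.1)
  ext
  · simp [argsInv, args, h.right_inv]
  · simp only [argsInv, args]
    field_simp
    ring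

theorem IsGlobal.val_injective (h : p.IsGlobal χ) (a : ℝ × ℝ) : Function.Injective (p.val a) := by
  have h1 := h.c₂_ne
  have h2 := h.φ₁_ne a.1
  have h3 := h.c₁_ne
  rintro ⟨f, g⟩ ⟨f', g'⟩ hw
  simp only [val, Prod.mk.injEq] at hw
  obtain ⟨hf, hg⟩ := hw
  have hf' : f = f' := mul_left_cancel₀ (by positivity) hf
  subst hf'
  have hg' := (div_left_inj' (pow_ne_zero 2 h3)).1 hg
  simp only [add_left_inj, mul_eq_mul_left_iff, h1, or_false] at hg'
  rw [hg']

/-- A global transformation as a homeomorphism of the extended space. -/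
def IsGlobal.homeo (h : p.IsGlobal χ) : Ext ≃ₜ Ext where
  toFun := p.ext
  invFun := p.extInv χ
  left_inv z := by
    have h1 := h.c₂_ne
    have h2 := h.φ₁_ne z.1.1.2.1
    have h3 := h.c₁_ne
    obtain ⟨⟨⟨t, x, u⟩, ut, ux⟩, f, g⟩ := z
    simp only [ext, extInv, jet, point, args, argsInv, val, J1.args, h.left_inv, Prod.mk.injEq] at *
    refine ⟨⟨⟨?_, trivial, ?_⟩, ?_, ?_⟩, ?_, ?_⟩ <;> field_simp <;> ring
  right_inv z := by
    have h1 := h.c₂_ne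
    have h2 := h.φ₁_ne (χ z.1.1.2.1)
    have h3 := h.c₁_ne
    obtain ⟨⟨⟨t, x, u⟩, ut, ux⟩, f, g⟩ := z
    simp only [ext, extInv, jet, point, args, argsInv, val, J1.args, h.right_inv,
      Prod.mk.injEq] at *
    refine ⟨⟨⟨?_, trivial, ?_⟩, ?_, ?_⟩, ?_, ?_⟩ <;> field_simp <;> ring
  continuous_toFun := h.contDiff_ext.continuous
  continuous_invFun := h.contDiff_extInv.continuous

/-- The image of a pair of arbitrary elements. -/
def image (p : Coeffs) (χ : ℝ → ℝ) (θ : Elements) : Elements where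
  dom := p.argsInv χ ⁻¹' θ.dom
  f b := (p.val (p.argsInv χ b) (θ.f (p.argsInv χ b), θ.g (p.argsInv χ b))).1
  g b := (p.val (p.argsInv χ b) (θ.f (p.argsInv χ b), θ.g (p.argsInv χ b))).2

theorem IsGlobal.mem_graph_image (h : p.IsGlobal χ) (θ : Elements) (w : Ext) :
    w ∈ θ.graph ↔ p.ext w ∈ (p.image χ θ).graph := by
  have e : (p.ext w).1.args = p.args w.1.args := rfl
  simp only [Elements.graph, mem_ofPred_eq, e, image, mem_preimage, h.argsInv_args]
  refine and_congr_right fun _ => ?_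
  exact (h.val_injective w.1.args).eq_iff.symm

theorem IsGlobal.isFirstProlongationAt (h : p.IsGlobal χ) (k : J1) :
    IsFirstProlongationAt p.point k (p.jet k) := by
  have d : DifferentiableAt ℝ p.point k.1 := by
    have h1 := (h.smooth_φ.differentiable (by simp)) k.1.2.1
    have h2 := (h.smooth_ψ.differentiable (by simp)) k.1.2.1
    unfold point
    fun_prop
  have key : ∀ v : J0, fderiv ℝ p.point k.1 v = (p.c₁ * v.1, p.φ₁ k.1.2.1 * v.2.1,
      p.c₂ * v.2.2 + (2 * p.c₄ * k.1.1 + p.c₃) * v.1 + p.ψ₁ k.1.2.1 * v.2.1) := by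
    intro v
    refine fderiv_eq_of_hasDerivAt_line d ?_
    have l : ∀ a b : ℝ, HasDerivAt (fun s : ℝ => a + s * b) b 0 := fun a b => by
      simpa using ((hasDerivAt_id (0 : ℝ)).mul_const b).const_add a
    have h1 : HasDerivAt p.φ (p.φ₁ k.1.2.1) (k.1.2.1 + 0 * v.2.1) := by
      simpa using h.hasDerivAt_φ k.1.2.1
    have h2 : HasDerivAt p.ψ (p.ψ₁ k.1.2.1) (k.1.2.1 + 0 * v.2.1) := by
      simpa using h.hasDerivAt_ψ k.1.2.1
    have h1 := h1.comp (0 : ℝ) (l k.1.2.1 v.2.1)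
    have h2 := h2.comp (0 : ℝ) (l k.1.2.1 v.2.1)
    refine HasDerivAt.prodMk ?_ (h1.prodMk ?_)
    · simpa using ((l k.1.1 v.1).const_mul p.c₁).add_const p.c₀
    · refine (((((l k.1.2.2 v.2.2).const_mul p.c₂).add
        (((l k.1.1 v.1).pow 2).const_mul p.c₄)).add ((l k.1.1 v.1).const_mul p.c₃)).add
          h2).congr_deriv ?_
      simp
      ring
  have h1 := h.φ₁_ne k.1.2.1
  have h3 := h.c₁_ne
  refine ⟨rfl, ?_, ?_⟩
  · simp only [key, jet, args, J1.args]
    field_simp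
    ring
  · simp only [key, jet, args, J1.args]
    field_simp
    ring

theorem IsGlobal.fderiv_jet (h : p.IsGlobal χ) (k v : J1) :
    (fderiv ℝ p.jet k v).1.1 = p.c₁ * v.1.1 ∧ (fderiv ℝ p.jet k v).1.2.1 = p.φ₁ k.1.2.1 * v.1.2.1 ∧
    (fderiv ℝ p.jet k v).2.1 = (p.c₂ * v.2.1 + 2 * p.c₄ * v.1.1) / p.c₁ ∧
    (fderiv ℝ p.jet k v).2.2 = (p.c₂ * v.2.2 + p.ψ₂ k.1.2.1 * v.1.2.1) / p.φ₁ k.1.2.1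
      - (p.c₂ * k.2.2 + p.ψ₁ k.1.2.1) * (p.φ₂ k.1.2.1 * v.1.2.1) / p.φ₁ k.1.2.1 ^ 2 := by
  have d : DifferentiableAt ℝ p.jet k := by
    have : ContDiff ℝ ∞ p.jet := by
      have := h.contDiff_ext.comp (contDiff_id.prodMk (contDiff_const (c := ((0, 0) : ℝ × ℝ))))
      exact contDiff_fst.comp this
    exact this.differentiable (by simp) k
  have l := d.hasFDerivAt.hasLineDerivAt v
  unfold HasLineDerivAt at l
  have l1 := HasDerivAt.prod_fst l
  have l2 := HasDerivAt.prod_snd l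
  have l0 : ∀ a b : ℝ, HasDerivAt (fun s : ℝ => a + s * b) b 0 := fun a b => by
      simpa using ((hasDerivAt_id (0 : ℝ)).mul_const b).const_add a
  have g1 : HasDerivAt p.φ (p.φ₁ k.1.2.1) (k.1.2.1 + 0 * v.1.2.1) := by
    simpa using h.hasDerivAt_φ k.1.2.1
  have g2 : HasDerivAt p.φ₁ (p.φ₂ k.1.2.1) (k.1.2.1 + 0 * v.1.2.1) := by
    simpa using h.hasDerivAt_φ₁ k.1.2.1
  have g3 : HasDerivAt p.ψ₁ (p.ψ₂ k.1.2.1) (k.1.2.1 + 0 * v.1.2.1) := by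
    simpa using h.hasDerivAt_ψ₁ k.1.2.1
  have g1 := g1.comp (0 : ℝ) (l0 k.1.2.1 v.1.2.1)
  have g2 := g2.comp (0 : ℝ) (l0 k.1.2.1 v.1.2.1)
  have g3 := g3.comp (0 : ℝ) (l0 k.1.2.1 v.1.2.1)
  have h1 := h.φ₁_ne k.1.2.1
  refine ⟨(HasDerivAt.prod_fst l1).unique ?_,
    (HasDerivAt.prod_fst (HasDerivAt.prod_snd l1)).unique ?_,
    (HasDerivAt.prod_fst l2).unique ?_, (HasDerivAt.prod_snd l2).unique ?_⟩
  · exact ((l0 k.1.1 v.1.1).const_mul p.c₁).add_const p.c₀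
  · exact g1
  · refine (((((l0 k.2.1 v.2.1).const_mul p.c₂).add
      ((l0 k.1.1 v.1.1).const_mul (2 * p.c₄))).add_const p.c₃).div_const p.c₁)
  · refine ((((l0 k.2.2 v.2.2).const_mul p.c₂).add g3).div g2 (by simpa using h1)).congr_deriv ?_
    simp
    field_simp

theorem IsGlobal.mapsEquationNear (h : p.IsGlobal χ) (θ : Elements) (j : J1) :
    MapsEquationNear p.jet θ (p.image χ θ) j := by
  refine Eventually.of_forall fun k q => ?_
  have h1 := h.φ₁_ne k.1.2.1
  have h2 := h.c₂_ne
  have h3 := h.c₁_ne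
  refine ⟨((p.c₂ * q.1 + 2 * p.c₄) / p.c₁ ^ 2, p.c₂ * q.2.1 / (p.c₁ * p.φ₁ k.1.2.1),
    ((p.c₂ * q.2.2 + p.ψ₂ k.1.2.1) / p.φ₁ k.1.2.1
      - (p.c₂ * k.2.2 + p.ψ₁ k.1.2.1) * p.φ₂ k.1.2.1 / p.φ₁ k.1.2.1 ^ 2) / p.φ₁ k.1.2.1),
    ⟨?_, ?_⟩, ?_⟩
  · obtain ⟨e1, e2, e3, e4⟩ := h.fderiv_jet k ((1, 0, k.2.1), (q.1, q.2.1))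
    simp only [e1, e2, e3, e4]
    constructor <;> field_simp <;> ring
  · obtain ⟨e1, e2, e3, e4⟩ := h.fderiv_jet k ((0, 1, k.2.2), (q.2.1, q.2.2))
    simp only [e1, e2, e3, e4]
    constructor <;> field_simp <;> ring
  · have e : (p.jet k).args = p.args k.args := rfl
    simp only [Elements.equation, mem_ofPred_eq, e, image, mem_preimage, h.argsInv_args, val]
    refine and_congr_right fun _ => ?_
    have e1 : k.args.1 = k.1.2.1 := rfl
    have e2 : k.args.2 = k.2.2 := rfl
    rw [e1, e2, ← sub_eq_zero, ← sub_eq_zero (a := _ / _)]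
    rw [show (p.c₂ * q.1 + 2 * p.c₄) / p.c₁ ^ 2 - (p.φ₁ k.1.2.1 ^ 2 / p.c₁ ^ 2 * θ.f k.args *
      (((p.c₂ * q.2.2 + p.ψ₂ k.1.2.1) / p.φ₁ k.1.2.1
      - (p.c₂ * k.2.2 + p.ψ₁ k.1.2.1) * p.φ₂ k.1.2.1 / p.φ₁ k.1.2.1 ^ 2) / p.φ₁ k.1.2.1) +
      (p.c₂ * θ.g k.args + ((p.c₂ * k.2.2 + p.ψ₁ k.1.2.1) * p.φ₂ k.1.2.1 / p.φ₁ k.1.2.1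
        - p.ψ₂ k.1.2.1) * θ.f k.args + 2 * p.c₄) / p.c₁ ^ 2)
      = p.c₂ / p.c₁ ^ 2 * (q.1 - (θ.f k.args * q.2.2 + θ.g k.args)) by field_simp; ring]
    simp [h2, h3]

theorem IsGlobal.contDiff_args (h : p.IsGlobal χ) : ContDiff ℝ ∞ p.args := by
  have h1 := h.smooth_φ
  have h2 := h.smooth_φ₁
  have h3 := h.smooth_ψ₁
  unfold args
  fun_prop (disch := exact fun a => h.φ₁_ne _)

theorem differentiableAt_slice {f : ℝ × ℝ → ℝ} {a : ℝ × ℝ} (h : DifferentiableAt ℝ f a) :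
    DifferentiableAt ℝ (fun q => f (a.1, q)) a.2 := by
  have h' : DifferentiableAt ℝ f (a.1, a.2) := h
  exact h'.comp a.2 ((differentiableAt_const a.1).prodMk differentiableAt_id)

/-- The second derivative of an affine reparametrization, up to an affine summand. -/
theorem iteratedDeriv_two_affine {G : ℝ → ℝ} {m n α β δ y : ℝ}
    (hG : ContDiffAt ℝ ∞ G (m * y + n)) :
    iteratedDeriv 2 (fun s => α * G (m * s + n) + (β * s + δ)) y
      = α * m ^ 2 * iteratedDeriv 2 G (m * y + n) := by
  have l : ∀ s, HasDerivAt (fun s : ℝ => m * s + n) m s := fun s => by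
    simpa using ((hasDerivAt_id s).const_mul m).add_const n
  have hc : ContinuousAt (fun s : ℝ => m * s + n) y := by fun_prop
  have e1 : ∀ᶠ s in 𝓝 y, deriv (fun s => α * G (m * s + n) + (β * s + δ)) s
      = α * m * deriv G (m * s + n) + β := by
    have : ∀ᶠ s in 𝓝 (m * y + n), ContDiffAt ℝ 1 G s :=
      (hG.of_le (by simp)).eventually (by simp)
    filter_upwards [hc.eventually this] with s hs
    have h1 := ((hs.differentiableAt (by simp)).hasDerivAt.comp s (l s)).const_mul α
    have h2 := ((hasDerivAt_id s).const_mul β).add_const δ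
    refine (h1.add h2).deriv.trans ?_
    ring
  rw [iteratedDeriv_succ, iteratedDeriv_one, iteratedDeriv_succ, iteratedDeriv_one]
  refine (EventuallyEq.deriv_eq e1).trans ?_
  have hd : DifferentiableAt ℝ (deriv G) (m * y + n) := by
    exact ((contDiffAt_infty.1 hG 2).derivWithin (m := 1)
      one_add_one_eq_two.le).differentiableAt one_ne_zero
  refine (((hd.hasDerivAt.comp y (l y)).const_mul (α * m)).add_const β).deriv.trans ?_
  ring

/-- A function on the plane whose derivatives in the second variable vanish on an open set is
locally independent of the second variable. -/
theorem eventually_eq_of_deriv_slice_eq_zero {f : ℝ × ℝ → ℝ} {V : Set (ℝ × ℝ)} (hV : IsOpen V)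
    (hf : DifferentiableOn ℝ f V) (h0 : ∀ a ∈ V, deriv (fun q => f (a.1, q)) a.2 = 0)
    {a : ℝ × ℝ} (ha : a ∈ V) : ∀ᶠ q in 𝓝 a.2, f (a.1, q) = f a := by
  obtain ⟨r, hr, hb⟩ := Metric.isOpen_iff.1 hV a ha
  have hmem : ∀ q ∈ Metric.ball a.2 r, (a.1, q) ∈ V := fun q hq => hb (by
    rw [Metric.mem_ball, Prod.dist_eq]; simpa [hr] using hq)
  filter_upwards [Metric.ball_mem_nhds a.2 hr] with q hq
  have := (convex_ball a.2 r).is_const_of_fderivWithin_eq_zero (𝕜 := ℝ)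
    (f := fun q => f (a.1, q)) (fun q hq => ?_) (fun q hq => ?_) hq (Metric.mem_ball_self hr)
  · simpa using this
  · exact (differentiableAt_slice (a := (a.1, q))
      (hf.differentiableAt (hV.mem_nhds (hmem q hq)))).differentiableWithinAt
  · rw [fderivWithin_of_isOpen Metric.isOpen_ball hq]
    ext
    simpa using h0 _ (hmem q hq)

theorem IsGlobal.admissible_image (h : p.IsGlobal χ) {θ : Elements} (hθ : θ.Admissible) :
    (p.image χ θ).Admissible := by
  have hχ := h.smooth_χ
  have hi := h.contDiff_argsInv
  have h1 := h.smooth_φ₁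
  have h2 := h.smooth_φ₂
  have h3 := h.smooth_ψ₁
  have h4 := h.smooth_ψ₂
  have hc := h.c₁_ne
  have hc2 := h.c₂_ne
  have hf : ContDiffOn ℝ ∞ (fun b => θ.f (p.argsInv χ b)) (p.argsInv χ ⁻¹' θ.dom) :=
    hθ.contDiffOn_f.comp hi.contDiffOn fun _ h => h
  have hg : ContDiffOn ℝ ∞ (fun b => θ.g (p.argsInv χ b)) (p.argsInv χ ⁻¹' θ.dom) :=
    hθ.contDiffOn_g.comp hi.contDiffOn fun _ h => h
  refine ⟨hθ.isOpen_dom.preimage hi.continuous, ?_, ?_, ?_⟩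
  · have : ContDiff ℝ ∞ fun b => p.φ₁ (p.argsInv χ b).1 ^ 2 / p.c₁ ^ 2 := by fun_prop
    exact this.contDiffOn.mul hf
  · have e : ∀ b, p.φ₁ (p.argsInv χ b).1 ≠ 0 := fun _ => h.φ₁_ne _
    have : ContDiff ℝ ∞ fun b => (p.c₂ * (p.argsInv χ b).2 + p.ψ₁ (p.argsInv χ b).1)
        * p.φ₂ (p.argsInv χ b).1 / p.φ₁ (p.argsInv χ b).1 - p.ψ₂ (p.argsInv χ b).1 := by
      fun_prop (disch := exact e)
    exact (((contDiffOn_const.mul hg).add (this.contDiffOn.mul hf)).add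
      contDiffOn_const).div_const _
  · intro V hV hne hsub
    have hV0 : IsOpen (p.args ⁻¹' V) := hV.preimage h.contDiff_args.continuous
    have hsub0 : p.args ⁻¹' V ⊆ θ.dom := fun a ha => by
      simpa [image, h.argsInv_args] using hsub ha
    have hne0 : (p.args ⁻¹' V).Nonempty := by
      obtain ⟨b, hb⟩ := hne
      exact ⟨p.argsInv χ b, by simpa [h.args_argsInv] using hb⟩
    have hfd : ∀ a ∈ p.args ⁻¹' V, DifferentiableAt ℝ θ.f a := fun a ha =>
      (hθ.contDiffOn_f.differentiableOn (by simp)).differentiableAt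
        (hθ.isOpen_dom.mem_nhds (hsub0 ha))
    -- On the vertical line through the image of `a`, the inverse is affine.
    have inv_line : ∀ a s, p.argsInv χ ((p.args a).1, s)
        = (a.1, p.φ₁ a.1 / p.c₂ * s + -(p.ψ₁ a.1 / p.c₂)) := fun a s => by
      simp only [argsInv, args, h.left_inv, Prod.mk.injEq, true_and]
      ring
    have inv_pt : ∀ a, p.φ₁ a.1 / p.c₂ * (p.args a).2 + -(p.ψ₁ a.1 / p.c₂) = a.2 := fun a => by
      have := inv_line a (p.args a).2
      rw [Prod.mk.eta, h.argsInv_args] at this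
      exact (congrArg Prod.snd this).symm
    by_cases hcase : ∃ a ∈ p.args ⁻¹' V, deriv (fun q => θ.f (a.1, q)) a.2 ≠ 0
    · obtain ⟨a, ha, had⟩ := hcase
      refine ⟨p.args a, ha, fun hzero => had ?_⟩
      have hz := congrArg Prod.fst hzero
      simp only [image, val, inv_line] at hz
      have hd : HasDerivAt (fun q => θ.f (a.1, q)) (deriv (fun q => θ.f (a.1, q)) a.2)
          (p.φ₁ a.1 / p.c₂ * (p.args a).2 + -(p.ψ₁ a.1 / p.c₂)) := by
        rw [inv_pt]; exact (differentiableAt_slice (hfd a ha)).hasDerivAt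
      have hl : HasDerivAt (fun s : ℝ => p.φ₁ a.1 / p.c₂ * s + -(p.ψ₁ a.1 / p.c₂))
          (p.φ₁ a.1 / p.c₂) (p.args a).2 := by
        simpa using ((hasDerivAt_id (p.args a).2).const_mul (p.φ₁ a.1 / p.c₂)).add_const
          (-(p.ψ₁ a.1 / p.c₂))
      have := ((hd.comp (p.args a).2 hl).const_mul (p.φ₁ a.1 ^ 2 / p.c₁ ^ 2)).deriv
      rw [Function.comp_def] at this
      rw [this] at hz
      simpa [h.φ₁_ne a.1, hc, hc2] using hz
    · -- Here `f` is locally independent of `u_x`, so only `g` contributes to `g'_{pp}`.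
      push Not at hcase
      obtain ⟨a, ha, hane⟩ := hθ.nonlinear _ hV0 hne0 hsub0
      refine ⟨p.args a, ha, fun hzero => hane ?_⟩
      rw [hcase a ha]
      have hz := congrArg Prod.snd hzero
      simp only [image, val, inv_line] at hz
      have hconst := eventually_eq_of_deriv_slice_eq_zero hV0
        (fun a ha => (hfd a ha).differentiableWithinAt) hcase ha
      have hl : ContinuousAt (fun s : ℝ => p.φ₁ a.1 / p.c₂ * s + -(p.ψ₁ a.1 / p.c₂))
        (p.args a).2 := by fun_prop
      simp only [ContinuousAt] at hl
      rw [inv_pt] at hl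
      have hgd : ContDiffAt ℝ ∞ (fun q => θ.g (a.1, q))
          (p.φ₁ a.1 / p.c₂ * (p.args a).2 + -(p.ψ₁ a.1 / p.c₂)) := by
        rw [inv_pt]
        have : ContDiffAt ℝ ∞ θ.g (a.1, a.2) :=
          hθ.contDiffOn_g.contDiffAt (hθ.isOpen_dom.mem_nhds (hsub0 ha))
        exact this.comp a.2 (contDiffAt_const.prodMk contDiffAt_id)
      have key := iteratedDeriv_two_affine (α := p.c₂ / p.c₁ ^ 2)
        (β := p.φ₁ a.1 * p.φ₂ a.1 / p.φ₁ a.1 * θ.f a / p.c₁ ^ 2)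
        (δ := (- p.ψ₂ a.1 * θ.f a + 2 * p.c₄) / p.c₁ ^ 2) hgd
      rw [inv_pt] at key
      rw [Prod.mk.injEq]
      refine ⟨rfl, ?_⟩
      have hφ := h.φ₁_ne a.1
      have hcoef : p.c₂ / p.c₁ ^ 2 * (p.φ₁ a.1 / p.c₂) ^ 2 ≠ 0 := by positivity
      refine (mul_eq_zero.1 (key.symm.trans ?_)).resolve_left hcoef
      refine (EventuallyEq.iteratedDeriv_eq 2 ?_).trans hz
      filter_upwards [hl.eventually hconst] with s hs
      simp only [hs]
      field_simp
      ring

/-- A transformation of the explicit form that is defined everywhere is an equivalence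
transformation. -/
theorem IsGlobal.isEquivalenceTransformation (h : p.IsGlobal χ) :
    IsEquivalenceTransformation h.homeo.toOpenPartialHomeomorph where
  smooth := h.contDiff_ext.contDiffOn
  smooth_symm := h.contDiff_extInv.contDiffOn
  preserves := ⟨p.point, p.jet, fun _ _ => rfl, fun _ _ => rfl,
    fun z _ => h.isFirstProlongationAt z.1, fun θ hθ z _ _ => ⟨p.image χ θ, h.admissible_image hθ,
      Eventually.of_forall fun w => h.mem_graph_image θ w, h.mapsEquationNear θ z.1⟩⟩

end Coeffs

/-- The coefficients of the composition of reflections that multiplies `t`, `x`, `u` by `a`, `b`,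
`c`. -/
def reflCoeffs (a b c : ℝ) : Coeffs where
  c₀ := 0
  c₁ := a
  c₂ := c
  c₃ := 0
  c₄ := 0
  φ x := b * x
  φ₁ _ := b
  φ₂ _ := 0
  ψ _ := 0
  ψ₁ _ := 0
  ψ₂ _ := 0

theorem isGlobal_reflCoeffs {a b c : ℝ} (ha : a ≠ 0) (hb : b * b = 1) (hc : c ≠ 0) :
    (reflCoeffs a b c).IsGlobal (fun x => b * x) where
  c₁_ne := ha
  c₂_ne := hc
  φ₁_ne _ := left_ne_zero_of_mul (hb.trans_ne one_ne_zero)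
  left_inv x := by simp [reflCoeffs, ← mul_assoc, hb]
  right_inv x := by simp [reflCoeffs, ← mul_assoc, hb]
  hasDerivAt_φ x := by
    have := (hasDerivAt_id x).const_mul b
    rwa [mul_one] at this
  hasDerivAt_φ₁ x := hasDerivAt_const x b
  hasDerivAt_ψ x := hasDerivAt_const x 0
  hasDerivAt_ψ₁ x := hasDerivAt_const x 0
  smooth_φ₂ := contDiff_const
  smooth_ψ₂ := contDiff_const
  smooth_χ := by fun_prop

theorem isEquivalenceTransformation_reflection {e : Ext ≃ₜ Ext} {a b c : ℝ} (ha : a ≠ 0)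
    (hb : b * b = 1) (hc : c ≠ 0) (h : ∀ z, e z = (reflCoeffs a b c).ext z) :
    IsEquivalenceTransformation e.toOpenPartialHomeomorph := by
  have : e = (isGlobal_reflCoeffs ha hb hc).homeo := Homeomorph.ext h
  rw [this]
  exact (isGlobal_reflCoeffs ha hb hc).isEquivalenceTransformation

theorem reflectT_eq (z : Ext) : reflectT z = (reflCoeffs (-1) 1 1).ext z := by
  simp [reflectT, reflCoeffs, Coeffs.ext, Coeffs.jet, Coeffs.point, Coeffs.args, Coeffs.val,
    J1.args, div_neg]

theorem reflectX_eq (z : Ext) : reflectX z = (reflCoeffs 1 (-1) 1).ext z := by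
  simp [reflectX, reflCoeffs, Coeffs.ext, Coeffs.jet, Coeffs.point, Coeffs.args, Coeffs.val,
    J1.args, div_neg]

theorem reflectU_eq (z : Ext) : reflectU z = (reflCoeffs 1 1 (-1)).ext z := by
  simp [reflectU, reflCoeffs, Coeffs.ext, Coeffs.jet, Coeffs.point, Coeffs.args, Coeffs.val,
    J1.args]

/-! ### First-order consequences of preserving the class -/

/-- The local diffeomorphism `Φ` projects to the point transformation `P` and to its first
prolongation `Q`, and it preserves the class of equations. -/
structure Preserves (Φ : OpenPartialHomeomorph Ext Ext) (P : J0 → J0) (Q : J1 → J1) : Prop where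
  smooth : ContDiffOn ℝ ∞ Φ Φ.source
  smooth_symm : ContDiffOn ℝ ∞ Φ.symm Φ.target
  point : ∀ z ∈ Φ.source, (Φ z).1.1 = P z.1.1
  jet : ∀ z ∈ Φ.source, (Φ z).1 = Q z.1
  prolongation : ∀ z ∈ Φ.source, IsFirstProlongationAt P z.1 (Q z.1)
  preserves : ∀ θ : Elements, θ.Admissible → ∀ z ∈ Φ.source, z ∈ θ.graph →
      ∃ θ' : Elements, θ'.Admissible ∧
        (∀ᶠ w in 𝓝 z, w ∈ θ.graph ↔ Φ w ∈ θ'.graph) ∧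
        MapsEquationNear Q θ θ' z.1

/-- The arbitrary elements `f = f₀ + (u_x - p₀)`, `g = g₀`, through a given point of the extended
space. They suffice to test whether a transformation preserves the class. -/
def testElements (z : Ext) : Elements where
  dom := univ
  f a := z.2.1 + (a.2 - z.1.2.2)
  g _ := z.2.2

theorem admissible_testElements (z : Ext) : (testElements z).Admissible where
  isOpen_dom := isOpen_univ
  contDiffOn_f := by unfold testElements; fun_prop
  contDiffOn_g := contDiffOn_const
  nonlinear := fun V _ hne _ => by
    obtain ⟨a, ha⟩ := hne
    refine ⟨a, ha, fun h => ?_⟩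
    have h1 := congrArg Prod.fst h
    have : HasDerivAt (fun p => z.2.1 + (p - z.1.2.2)) 1 a.2 :=
      ((hasDerivAt_id a.2).sub_const z.1.2.2).const_add z.2.1
    simp only [testElements, this.deriv] at h1
    exact one_ne_zero h1

theorem mem_graph_testElements (z : Ext) : z ∈ (testElements z).graph :=
  ⟨mem_univ _, by simp [testElements, J1.args]⟩

theorem eq_zero_of_det_ne_zero {a₁ a₂ b₁ b₂ x y : ℝ} (hd : a₁ * b₂ - a₂ * b₁ ≠ 0)
    (h1 : a₁ * x + a₂ * y = 0) (h2 : b₁ * x + b₂ * y = 0) : x = 0 ∧ y = 0 := by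
  refine ⟨(mul_eq_zero.1 (?_ : (a₁ * b₂ - a₂ * b₁) * x = 0)).resolve_left hd,
    (mul_eq_zero.1 (?_ : (a₁ * b₂ - a₂ * b₁) * y = 0)).resolve_left hd⟩
  · linear_combination b₂ * h1 - a₂ * h2
  · linear_combination a₁ * h2 - b₁ * h1

/-- The algebra of the second prolongation at a single jet. With `M = (a₁, a₂; b₁, b₂)`, the
transformed Hessian `H'` satisfies `M (H' - H₀') Mᵀ = l H`, so that the affine hyperplane
`q_tt = f q_xx + g` in the space of Hessians is mapped to `q'_tt = f' q'_xx + g'` only if the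
quadratic forms `diag (1, -f')` and `Mᵀ diag (1, -f) M` are proportional. -/
theorem coefficient_relations {a₁ a₂ b₁ b₂ l vt wt vx wx f g f' g' : ℝ} {nV nW : ℝ → ℝ → ℝ}
    (hd : a₁ * b₂ - a₂ * b₁ ≠ 0) (hl : l ≠ 0)
    (ha : ∀ α β, nV α β * a₁ + nW α β * a₂ = l * α)
    (hb : ∀ α β, nV α β * b₁ + nW α β * b₂ = l * β)
    (hq : ∀ q₁ q₂ q₃ : ℝ, ∃ r₁ r₂ r₃ : ℝ, vt + nV q₁ q₂ = r₁ * a₁ + r₂ * a₂ ∧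
      wt + nW q₁ q₂ = r₂ * a₁ + r₃ * a₂ ∧ vx + nV q₂ q₃ = r₁ * b₁ + r₂ * b₂ ∧
      wx + nW q₂ q₃ = r₂ * b₁ + r₃ * b₂ ∧ (q₁ = f * q₃ + g ↔ r₁ = f' * r₃ + g')) :
    a₁ * a₂ = f * (b₁ * b₂) ∧ (a₁ ^ 2 - f * b₁ ^ 2) * f' + (a₂ ^ 2 - f * b₂ ^ 2) = 0 := by
  have hn : nV 0 0 = 0 ∧ nW 0 0 = 0 :=
    eq_zero_of_det_ne_zero hd (by linarith [ha 0 0]) (by linarith [hb 0 0])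
  obtain ⟨p₁, p₂, p₃, e1, e2, e3, e4, -⟩ := hq 0 0 0
  rw [hn.1, add_zero] at e1 e3
  rw [hn.2, add_zero] at e2 e4
  -- every Hessian `p + d` is attained, at an explicit argument
  have key : ∀ d₁ d₂ d₃ : ℝ,
      ((a₁ ^ 2 * d₁ + 2 * a₁ * a₂ * d₂ + a₂ ^ 2 * d₃) / l
        = f * ((b₁ ^ 2 * d₁ + 2 * b₁ * b₂ * d₂ + b₂ ^ 2 * d₃) / l) + g ↔
      p₁ + d₁ = f' * (p₃ + d₃) + g') := by
    intro d₁ d₂ d₃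
    obtain ⟨r₁, r₂, r₃, g1, g2, g3, g4, g5⟩ :=
      hq ((a₁ ^ 2 * d₁ + 2 * a₁ * a₂ * d₂ + a₂ ^ 2 * d₃) / l)
        ((a₁ * b₁ * d₁ + (a₁ * b₂ + a₂ * b₁) * d₂ + a₂ * b₂ * d₃) / l)
        ((b₁ ^ 2 * d₁ + 2 * b₁ * b₂ * d₂ + b₂ ^ 2 * d₃) / l)
    set q₁ := (a₁ ^ 2 * d₁ + 2 * a₁ * a₂ * d₂ + a₂ ^ 2 * d₃) / l with hq1
    set q₂ := (a₁ * b₁ * d₁ + (a₁ * b₂ + a₂ * b₁) * d₂ + a₂ * b₂ * d₃) / l with hq2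
    set q₃ := (b₁ ^ 2 * d₁ + 2 * b₁ * b₂ * d₂ + b₂ ^ 2 * d₃) / l with hq3
    have k1 : l * q₁ = a₁ ^ 2 * d₁ + 2 * a₁ * a₂ * d₂ + a₂ ^ 2 * d₃ := by
      rw [hq1]; field_simp
    have k2 : l * q₂ = a₁ * b₁ * d₁ + (a₁ * b₂ + a₂ * b₁) * d₂ + a₂ * b₂ * d₃ := by
      rw [hq2]; field_simp
    have k3 : l * q₃ = b₁ ^ 2 * d₁ + 2 * b₁ * b₂ * d₂ + b₂ ^ 2 * d₃ := by
      rw [hq3]; field_simp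
    have m1 := ha q₁ q₂
    have m2 := hb q₁ q₂
    have m3 := ha q₂ q₃
    have m4 := hb q₂ q₃
    have n1 : nV q₁ q₂ = (r₁ - p₁) * a₁ + (r₂ - p₂) * a₂ := by linear_combination g1 - e1
    have n2 : nW q₁ q₂ = (r₂ - p₂) * a₁ + (r₃ - p₃) * a₂ := by linear_combination g2 - e2
    have n3 : nV q₂ q₃ = (r₁ - p₁) * b₁ + (r₂ - p₂) * b₂ := by linear_combination g3 - e3
    have n4 : nW q₂ q₃ = (r₂ - p₂) * b₁ + (r₃ - p₃) * b₂ := by linear_combination g4 - e4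
    rw [n1, n2, k1] at m1
    rw [n1, n2, k2] at m2
    rw [n3, n4, k2] at m3
    rw [n3, n4, k3] at m4
    obtain ⟨x1, x2⟩ := eq_zero_of_det_ne_zero (x := a₁ * (r₁ - p₁ - d₁) + a₂ * (r₂ - p₂ - d₂))
      (y := a₁ * (r₂ - p₂ - d₂) + a₂ * (r₃ - p₃ - d₃)) hd
      (by linear_combination m1) (by linear_combination m2)
    obtain ⟨x3, x4⟩ := eq_zero_of_det_ne_zero (x := b₁ * (r₁ - p₁ - d₁) + b₂ * (r₂ - p₂ - d₂))
      (y := b₁ * (r₂ - p₂ - d₂) + b₂ * (r₃ - p₃ - d₃)) hd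
      (by linear_combination m3) (by linear_combination m4)
    have y1 := (eq_zero_of_det_ne_zero hd x1 x3).1
    have y2 := (eq_zero_of_det_ne_zero hd x2 x4).2
    rw [g5, show r₁ = p₁ + d₁ by linarith, show r₃ = p₃ + d₃ by linarith]
  have key' : ∀ d₂ d₃ : ℝ, (a₁ ^ 2 - f * b₁ ^ 2) * (f' * (p₃ + d₃) + g' - p₁)
      + 2 * (a₁ * a₂ - f * (b₁ * b₂)) * d₂ + (a₂ ^ 2 - f * b₂ ^ 2) * d₃ = l * g := by
    intro d₂ d₃
    have := (key (f' * (p₃ + d₃) + g' - p₁) d₂ d₃).2 (by ring)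
    field_simp at this
    linear_combination this
  have h00 := key' 0 0
  have h10 := key' 1 0
  have h01 := key' 0 1
  constructor <;> linarith

theorem eventually_line {E : Type*} [NormedAddCommGroup E] [NormedSpace ℝ E] {p : E → Prop}
    {x : E} (hp : ∀ᶠ y in 𝓝 x, p y) (v : E) : ∀ᶠ s : ℝ in 𝓝 0, p (x + s • v) := by
  have : ContinuousAt (fun s : ℝ => x + s • v) 0 := by fun_prop
  unfold ContinuousAt at this
  simp only [zero_smul, add_zero] at this
  exact this.eventually hp

/-- The total derivative `D_t` of the point transformation `P` at a jet. -/
def totalT (P : J0 → J0) (k : J1) : J0 := fderiv ℝ P k.1 (1, 0, k.2.1)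

/-- The total derivative `D_x` of the point transformation `P` at a jet. -/
def totalX (P : J0 → J0) (k : J1) : J0 := fderiv ℝ P k.1 (0, 1, k.2.2)

theorem totalT_add (k : J1) (α : ℝ) (P : J0 → J0) :
    fderiv ℝ P k.1 (1, 0, k.2.1 + α) = totalT P k + α • fderiv ℝ P k.1 (0, 0, 1) := by
  rw [totalT, ← map_smul, ← map_add]; simp

theorem totalX_add (k : J1) (α : ℝ) (P : J0 → J0) :
    fderiv ℝ P k.1 (0, 1, k.2.2 + α) = totalX P k + α • fderiv ℝ P k.1 (0, 0, 1) := by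
  rw [totalX, ← map_smul, ← map_add]; simp

/-- The nonvanishing factor `U_u - U^t T_u - U^x X_u`. -/
def contactFactor (P : J0 → J0) (Q : J1 → J1) (k : J1) : ℝ :=
  (fderiv ℝ P k.1 (0, 0, 1)).2.2 - (Q k).2.1 * (fderiv ℝ P k.1 (0, 0, 1)).1
    - (Q k).2.2 * (fderiv ℝ P k.1 (0, 0, 1)).2.1

namespace Preserves

variable {Φ : OpenPartialHomeomorph Ext Ext} {P : J0 → J0} {Q : J1 → J1} {z : Ext}

theorem contDiffAt (h : Preserves Φ P Q) (hz : z ∈ Φ.source) : ContDiffAt ℝ ∞ Φ z :=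
  h.smooth.contDiffAt (Φ.open_source.mem_nhds hz)

theorem eventually_mem (hz : z ∈ Φ.source) : ∀ᶠ k in 𝓝 z.1, (k, z.2) ∈ Φ.source := by
  have : ContinuousAt (fun k : J1 => ((k, z.2) : Ext)) z.1 := by fun_prop
  exact this.eventually (Φ.open_source.mem_nhds (by simpa using hz))

theorem eventually_mem' (hz : z ∈ Φ.source) : ∀ᶠ y in 𝓝 z.1.1, ((y, z.1.2), z.2) ∈ Φ.source := by
  have : ContinuousAt (fun y : J0 => (((y, z.1.2), z.2) : Ext)) z.1.1 := by fun_prop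
  exact this.eventually (Φ.open_source.mem_nhds (by simpa using hz))

theorem contDiffAt_jet (h : Preserves Φ P Q) (hz : z ∈ Φ.source) : ContDiffAt ℝ ∞ Q z.1 := by
  have h1 : ContDiffAt ℝ ∞ (fun k => (Φ (k, z.2)).1) z.1 :=
    ContDiffAt.fst (ContDiffAt.comp z.1 (g := Φ) (f := fun k : J1 => ((k, z.2) : Ext))
      (h.contDiffAt hz) (by fun_prop))
  refine h1.congr_of_eventuallyEq ?_
  filter_upwards [eventually_mem hz] with k hk using (h.jet _ hk).symm

theorem contDiffAt_point (h : Preserves Φ P Q) (hz : z ∈ Φ.source) :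
    ContDiffAt ℝ ∞ P z.1.1 := by
  have h1 : ContDiffAt ℝ ∞ (fun y => (Φ ((y, z.1.2), z.2)).1.1) z.1.1 :=
    ContDiffAt.fst (ContDiffAt.fst (ContDiffAt.comp z.1.1 (g := Φ)
      (f := fun y : J0 => (((y, z.1.2), z.2) : Ext)) (h.contDiffAt hz) (by fun_prop)))
  refine h1.congr_of_eventuallyEq ?_
  filter_upwards [eventually_mem' hz] with k hk using (h.point _ hk).symm

theorem jet_fst (h : Preserves Φ P Q) (hz : z ∈ Φ.source) : (Q z.1).1 = P z.1.1 := by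
  rw [← h.jet z hz, h.point z hz]

theorem fderiv_jet_fst (h : Preserves Φ P Q) (hz : z ∈ Φ.source) (v : J1) :
    (fderiv ℝ Q z.1 v).1 = fderiv ℝ P z.1.1 v.1 := by
  have h1 : HasFDerivAt (fun k => (Q k).1)
      ((ContinuousLinearMap.fst ℝ _ _).comp (fderiv ℝ Q z.1)) z.1 :=
    (((h.contDiffAt_jet hz).differentiableAt (by simp)).hasFDerivAt).fst
  have h2 : HasFDerivAt (fun k : J1 => P k.1)
      ((fderiv ℝ P z.1.1).comp (ContinuousLinearMap.fst ℝ _ _)) z.1 :=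
    (((h.contDiffAt_point hz).differentiableAt (by simp)).hasFDerivAt).comp z.1 hasFDerivAt_fst
  have h3 : (fun k => (Q k).1) =ᶠ[𝓝 z.1] fun k : J1 => P k.1 := by
    filter_upwards [eventually_mem hz] with k hk using h.jet_fst hk
  exact DFunLike.congr_fun (h1.unique (h2.congr_of_eventuallyEq h3)) v

theorem fderiv_fst (h : Preserves Φ P Q) (hz : z ∈ Φ.source) (v : Ext) :
    (fderiv ℝ Φ z v).1 = fderiv ℝ Q z.1 v.1 := by
  have h1 : HasFDerivAt (fun k => (Φ k).1)
      ((ContinuousLinearMap.fst ℝ _ _).comp (fderiv ℝ Φ z)) z :=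
    (((h.contDiffAt hz).differentiableAt (by simp)).hasFDerivAt).fst
  have h2 : HasFDerivAt (fun k : Ext => Q k.1)
      ((fderiv ℝ Q z.1).comp (ContinuousLinearMap.fst ℝ _ _)) z :=
    (((h.contDiffAt_jet hz).differentiableAt (by simp)).hasFDerivAt).comp z hasFDerivAt_fst
  have h3 : (fun k => (Φ k).1) =ᶠ[𝓝 z] fun k : Ext => Q k.1 := by
    filter_upwards [Φ.open_source.mem_nhds hz] with k hk using h.jet _ hk
  exact DFunLike.congr_fun (h1.unique (h2.congr_of_eventuallyEq h3)) v

theorem surjective_fderiv (h : Preserves Φ P Q) (hz : z ∈ Φ.source) :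
    Function.Surjective (fderiv ℝ Φ z) := by
  have ht := Φ.map_source hz
  have h1 := ((h.contDiffAt hz).differentiableAt (by simp)).hasFDerivAt
  have h2 := ((h.smooth_symm.contDiffAt (Φ.open_target.mem_nhds ht)).differentiableAt
    (by simp)).hasFDerivAt
  rw [← Φ.left_inv hz] at h1
  have h3 := h1.comp (Φ z) h2
  have h4 := (hasFDerivAt_id (𝕜 := ℝ) (Φ z)).congr_of_eventuallyEq
    (f₁ := Φ ∘ Φ.symm) (by
      filter_upwards [Φ.open_target.mem_nhds ht] with w hw using Φ.right_inv hw)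
  rw [Φ.left_inv hz] at h3
  exact fun v => ⟨_, DFunLike.congr_fun (h3.unique h4) v⟩

theorem surjective_fderiv_jet (h : Preserves Φ P Q) (hz : z ∈ Φ.source) :
    Function.Surjective (fderiv ℝ Q z.1) := fun v => by
  obtain ⟨w, hw⟩ := h.surjective_fderiv hz (v, 0)
  exact ⟨w.1, by rw [← h.fderiv_fst hz, hw]⟩

theorem injective_fderiv_jet (h : Preserves Φ P Q) (hz : z ∈ Φ.source) :
    Function.Injective (fderiv ℝ Q z.1) :=
  (LinearMap.injective_iff_surjective (f := (fderiv ℝ Q z.1).toLinearMap)).2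
    (h.surjective_fderiv_jet hz)

theorem injective_fderiv_point (h : Preserves Φ P Q) (hz : z ∈ Φ.source) :
    Function.Injective (fderiv ℝ P z.1.1) := by
  refine (LinearMap.injective_iff_surjective (f := (fderiv ℝ P z.1.1).toLinearMap)).2 fun v => ?_
  obtain ⟨w, hw⟩ := h.surjective_fderiv_jet hz (v, 0)
  exact ⟨w.1, by simp [← h.fderiv_jet_fst hz, hw]⟩

theorem prolong_t (h : Preserves Φ P Q) (hz : z ∈ Φ.source) :
    (totalT P z.1).2.2 = (Q z.1).2.1 * (totalT P z.1).1 + (Q z.1).2.2 * (totalT P z.1).2.1 :=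
  (h.prolongation z hz).2.1

theorem prolong_x (h : Preserves Φ P Q) (hz : z ∈ Φ.source) :
    (totalX P z.1).2.2 = (Q z.1).2.1 * (totalX P z.1).1 + (Q z.1).2.2 * (totalX P z.1).2.1 :=
  (h.prolongation z hz).2.2

theorem det_ne_zero (h : Preserves Φ P Q) (hz : z ∈ Φ.source) :
    (totalT P z.1).1 * (totalX P z.1).2.1 - (totalT P z.1).2.1 * (totalX P z.1).1 ≠ 0 := by
  intro hdet
  -- a vanishing combination of the two total derivatives is tangent to the kernel of `dP`
  have key : ∀ α β : ℝ, α * (totalT P z.1).1 + β * (totalX P z.1).1 = 0 →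
      α * (totalT P z.1).2.1 + β * (totalX P z.1).2.1 = 0 → α = 0 ∧ β = 0 := by
    intro α β h1 h2
    have h0 : fderiv ℝ P z.1.1 (α • (1, 0, z.1.2.1) + β • (0, 1, z.1.2.2)) = 0 := by
      rw [map_add, map_smul, map_smul]
      change α • totalT P z.1 + β • totalX P z.1 = 0
      refine Prod.ext h1 (Prod.ext h2 ?_)
      change α * (totalT P z.1).2.2 + β * (totalX P z.1).2.2 = 0
      rw [h.prolong_t hz, h.prolong_x hz]
      linear_combination (Q z.1).2.1 * h1 + (Q z.1).2.2 * h2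
    have h3 := h.injective_fderiv_point hz (h0.trans (map_zero _).symm)
    simpa using And.intro (congrArg (fun v : J0 => v.1) h3) (congrArg (fun v : J0 => v.2.1) h3)
  obtain ⟨x1, x2⟩ := key (totalX P z.1).1 (-(totalT P z.1).1) (by ring) (by linarith)
  obtain ⟨y1, y2⟩ := key (totalX P z.1).2.1 (-(totalT P z.1).2.1) (by linarith) (by ring)
  exact one_ne_zero (key 1 0 (by linarith) (by linarith)).1

theorem hasDerivAt_jet_line (h : Preserves Φ P Q) (hz : z ∈ Φ.source) (v : J1) :
    HasDerivAt (fun s : ℝ => Q (z.1 + s • v)) (fderiv ℝ Q z.1 v) 0 :=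
  ((h.contDiffAt_jet hz).differentiableAt (by simp)).hasFDerivAt.hasLineDerivAt v

/-- The derivative of the prolongation formulas along the fibres of the jet space. -/
theorem fibre_derivative (h : Preserves Φ P Q) (hz : z ∈ Φ.source) (α β : ℝ) :
    (fderiv ℝ Q z.1 (0, (α, β))).2.1 * (totalT P z.1).1
      + (fderiv ℝ Q z.1 (0, (α, β))).2.2 * (totalT P z.1).2.1 = contactFactor P Q z.1 * α ∧
    (fderiv ℝ Q z.1 (0, (α, β))).2.1 * (totalX P z.1).1
      + (fderiv ℝ Q z.1 (0, (α, β))).2.2 * (totalX P z.1).2.1 = contactFactor P Q z.1 * β := by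
  have l := h.hasDerivAt_jet_line hz (0, (α, β))
  have lV := HasDerivAt.prod_fst (HasDerivAt.prod_snd l)
  have lW := HasDerivAt.prod_snd (HasDerivAt.prod_snd l)
  have hl : ∀ c d : ℝ, HasDerivAt (fun s : ℝ => c + s * d) d 0 := fun c d => by
    simpa using ((hasDerivAt_id (0 : ℝ)).mul_const d).const_add c
  have hm := eventually_line (eventually_mem hz) (0, (α, β))
  have tT : ∀ s : ℝ, totalT P (z.1 + s • (0, (α, β)))
      = totalT P z.1 + (s * α) • fderiv ℝ P z.1.1 (0, 0, 1) := fun s => by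
    rw [← totalT_add]; simp [totalT]
  have tX : ∀ s : ℝ, totalX P (z.1 + s • (0, (α, β)))
      = totalX P z.1 + (s * β) • fderiv ℝ P z.1.1 (0, 0, 1) := fun s => by
    rw [← totalX_add]; simp [totalX]
  have lin : ∀ (c d : ℝ) (e : ℝ), HasDerivAt (fun s : ℝ => c + s * d * e) (d * e) 0 :=
    fun c d e => by simpa [mul_assoc] using hl c (d * e)
  constructor
  · have e1 := (lV.mul (lin (totalT P z.1).1 α (fderiv ℝ P z.1.1 (0, 0, 1)).1)).add
      (lW.mul (lin (totalT P z.1).2.1 α (fderiv ℝ P z.1.1 (0, 0, 1)).2.1))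
    have e2 := lin (totalT P z.1).2.2 α (fderiv ℝ P z.1.1 (0, 0, 1)).2.2
    have e3 := e1.unique (e2.congr_of_eventuallyEq (by
      filter_upwards [hm] with s hs
      have := h.prolong_t hs
      rw [tT] at this
      simpa using this.symm))
    simp only [zero_smul, add_zero, zero_mul] at e3
    unfold contactFactor
    linear_combination e3
  · have e1 := (lV.mul (lin (totalX P z.1).1 β (fderiv ℝ P z.1.1 (0, 0, 1)).1)).add
      (lW.mul (lin (totalX P z.1).2.1 β (fderiv ℝ P z.1.1 (0, 0, 1)).2.1))
    have e2 := lin (totalX P z.1).2.2 β (fderiv ℝ P z.1.1 (0, 0, 1)).2.2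
    have e3 := e1.unique (e2.congr_of_eventuallyEq (by
      filter_upwards [hm] with s hs
      have := h.prolong_x hs
      rw [tX] at this
      simpa using this.symm))
    simp only [zero_smul, add_zero, zero_mul] at e3
    unfold contactFactor
    linear_combination e3

theorem contactFactor_ne_zero (h : Preserves Φ P Q) (hz : z ∈ Φ.source) :
    contactFactor P Q z.1 ≠ 0 := by
  intro h0
  obtain ⟨h1, h2⟩ := h.fibre_derivative hz 1 0
  rw [h0, zero_mul] at h1 h2
  obtain ⟨h3, h4⟩ := eq_zero_of_det_ne_zero (h.det_ne_zero hz)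
    (x := (fderiv ℝ Q z.1 (0, (1, 0))).2.1) (y := (fderiv ℝ Q z.1 (0, (1, 0))).2.2)
    (by linarith) (by linarith)
  have h5 : fderiv ℝ Q z.1 (0, (1, 0)) = 0 := by
    refine Prod.ext ?_ (Prod.ext h3 h4)
    rw [h.fderiv_jet_fst hz]
    simp
  have h6 := h.injective_fderiv_jet hz (h5.trans (map_zero _).symm)
  exact one_ne_zero (congrArg (fun v : J1 => v.2.1) h6)

/-- The condition on the equations at a single jet, expressed through the values of `Φ`. -/
theorem exists_hessian (h : Preserves Φ P Q) (hz : z ∈ Φ.source) (q : ℝ × ℝ × ℝ) :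
    ∃ q' : ℝ × ℝ × ℝ, IsSecondProlongationAt Q z.1 q q' ∧
      (q.1 = z.2.1 * q.2.2 + z.2.2 ↔ q'.1 = (Φ z).2.1 * q'.2.2 + (Φ z).2.2) := by
  obtain ⟨θ', -, hgr, hmap⟩ := h.preserves _ (admissible_testElements z) z hz
    (mem_graph_testElements z)
  obtain ⟨q', h1, h2⟩ := hmap.self_of_nhds q
  obtain ⟨h3, h4⟩ := hgr.self_of_nhds.1 (mem_graph_testElements z)
  refine ⟨q', h1, ?_⟩
  rw [h.jet z hz] at h3 h4
  have e : z.1.args.2 = z.1.2.2 := rfl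
  simp only [Elements.equation, mem_ofPred_eq, h3, true_and, testElements, mem_univ, e,
    sub_self, add_zero] at h2
  rw [h2, h4]

theorem relations (h : Preserves Φ P Q) (hz : z ∈ Φ.source) :
    (totalT P z.1).1 * (totalT P z.1).2.1
      = z.2.1 * ((totalX P z.1).1 * (totalX P z.1).2.1) ∧
    ((totalT P z.1).1 ^ 2 - z.2.1 * (totalX P z.1).1 ^ 2) * (Φ z).2.1
      + ((totalT P z.1).2.1 ^ 2 - z.2.1 * (totalX P z.1).2.1 ^ 2) = 0 := by
  refine coefficient_relations (h.det_ne_zero hz) (h.contactFactor_ne_zero hz)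
    (nV := fun α β => (fderiv ℝ Q z.1 (0, (α, β))).2.1)
    (nW := fun α β => (fderiv ℝ Q z.1 (0, (α, β))).2.2)
    (vt := (fderiv ℝ Q z.1 ((1, 0, z.1.2.1), 0)).2.1)
    (wt := (fderiv ℝ Q z.1 ((1, 0, z.1.2.1), 0)).2.2)
    (vx := (fderiv ℝ Q z.1 ((0, 1, z.1.2.2), 0)).2.1)
    (wx := (fderiv ℝ Q z.1 ((0, 1, z.1.2.2), 0)).2.2) (g := z.2.2) (g' := (Φ z).2.2)
    (fun α β => (h.fibre_derivative hz α β).1) (fun α β => (h.fibre_derivative hz α β).2) ?_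
  intro q₁ q₂ q₃
  obtain ⟨q', ⟨⟨h1, h2⟩, h3, h4⟩, h5⟩ := h.exists_hessian hz (q₁, q₂, q₃)
  have split : ∀ (y : J0) (w : ℝ × ℝ),
      fderiv ℝ Q z.1 (y, w) = fderiv ℝ Q z.1 (y, 0) + fderiv ℝ Q z.1 (0, w) := fun y w => by
    rw [← map_add]; simp
  simp only [h.fderiv_jet_fst hz] at h1 h2 h3 h4
  refine ⟨q'.1, q'.2.1, q'.2.2, ?_, ?_, ?_, ?_, h5⟩
  · rw [split] at h1; exact h1
  · rw [split] at h2; exact h2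
  · rw [split] at h3; exact h3
  · rw [split] at h4; exact h4

theorem eventually_mem_f (hz : z ∈ Φ.source) :
    ∀ᶠ s : ℝ in 𝓝 0, (z.1, (z.2.1 + s, z.2.2)) ∈ Φ.source := by
  have : ContinuousAt (fun s : ℝ => ((z.1, (z.2.1 + s, z.2.2)) : Ext)) 0 := by fun_prop
  exact this.eventually (Φ.open_source.mem_nhds (by simpa using hz))

/-- The jet does not see `f`, so the relation `D_t T · D_t X = f · D_x T · D_x X` holds for an
interval of values of `f`. -/
theorem products_eq_zero (h : Preserves Φ P Q) (hz : z ∈ Φ.source) :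
    (totalT P z.1).1 * (totalT P z.1).2.1 = 0 ∧ (totalX P z.1).1 * (totalX P z.1).2.1 = 0 := by
  have hev := (eventually_mem_f hz).filter_mono (nhdsWithin_le_nhds (s := {0}ᶜ))
  obtain ⟨s, hs, hs0⟩ := (hev.and self_mem_nhdsWithin).exists
  have h1 := (h.relations hz).1
  have h2 := (h.relations hs).1
  have h3 : (totalX P z.1).1 * (totalX P z.1).2.1 = 0 :=
    (mul_eq_zero.1 (by linear_combination h1 - h2 : s * _ = 0)).resolve_left hs0
  exact ⟨by rw [h1, h3, mul_zero], h3⟩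

/-- The values of the transformed arbitrary elements along the graph of the test elements are
functions of the transformed `(x, u_x)`. -/
theorem exists_image (h : Preserves Φ P Q) (hz : z ∈ Φ.source) :
    ∃ F G : ℝ × ℝ → ℝ, DifferentiableAt ℝ F (Q z.1).args ∧ DifferentiableAt ℝ G (Q z.1).args ∧
      ∀ᶠ k in 𝓝 z.1, (k, (z.2.1 + (k.2.2 - z.1.2.2), z.2.2)) ∈ Φ.source ∧
        (Φ (k, (z.2.1 + (k.2.2 - z.1.2.2), z.2.2))).2 = (F (Q k).args, G (Q k).args) := by
  obtain ⟨θ', hθ', hgr, -⟩ := h.preserves _ (admissible_testElements z) z hz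
    (mem_graph_testElements z)
  have hdom : (Q z.1).args ∈ θ'.dom := by
    rw [← h.jet z hz]; exact (hgr.self_of_nhds.1 (mem_graph_testElements z)).1
  have hn := hθ'.isOpen_dom.mem_nhds hdom
  refine ⟨θ'.f, θ'.g, (hθ'.contDiffOn_f.contDiffAt hn).differentiableAt (by simp),
    (hθ'.contDiffOn_g.contDiffAt hn).differentiableAt (by simp), ?_⟩
  have hc : Tendsto (fun k : J1 => ((k, (z.2.1 + (k.2.2 - z.1.2.2), z.2.2)) : Ext)) (𝓝 z.1)
      (𝓝 z) := by
    have : ContinuousAt (fun k : J1 => ((k, (z.2.1 + (k.2.2 - z.1.2.2), z.2.2)) : Ext)) z.1 := by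
      fun_prop
    simpa [ContinuousAt] using this
  filter_upwards [hc.eventually hgr, hc.eventually (Φ.open_source.mem_nhds hz)] with k hk hs
  refine ⟨hs, ?_⟩
  have := (hk.1 ⟨mem_univ _, rfl⟩).2
  rw [h.jet _ hs] at this
  exact this

theorem hasDerivAt_args_line (h : Preserves Φ P Q) (hz : z ∈ Φ.source) (v : J1) :
    HasDerivAt (fun s : ℝ => (Q (z.1 + s • v)).args) (fderiv ℝ Q z.1 v).args 0 := by
  have l := h.hasDerivAt_jet_line hz v
  exact (HasDerivAt.prod_fst (HasDerivAt.prod_snd (HasDerivAt.prod_fst l))).prodMk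
    (HasDerivAt.prod_snd (HasDerivAt.prod_snd l))

theorem hasDerivAt_comp_args_line (h : Preserves Φ P Q) (hz : z ∈ Φ.source) (v : J1)
    {F : ℝ × ℝ → ℝ} (hF : DifferentiableAt ℝ F (Q z.1).args) :
    HasDerivAt (fun s : ℝ => F (Q (z.1 + s • v)).args)
      (fderiv ℝ F (Q z.1).args (fderiv ℝ Q z.1 v).args) 0 := by
  have h1 : HasFDerivAt F (fderiv ℝ F (Q z.1).args) (Q (z.1 + (0 : ℝ) • v)).args := by
    simpa using hF.hasFDerivAt
  exact h1.comp_hasDerivAt (0 : ℝ) (h.hasDerivAt_args_line hz v)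

theorem continuousAt_totalT (h : Preserves Φ P Q) (hz : z ∈ Φ.source) :
    ContinuousAt (totalT P) z.1 := by
  have h1 : ContinuousAt (fderiv ℝ P) z.1.1 := (h.contDiffAt_point hz).continuousAt_fderiv (by simp)
  have h2 : ContinuousAt (fun k : J1 => fderiv ℝ P k.1) z.1 :=
    ContinuousAt.comp (g := fderiv ℝ P) (f := fun k : J1 => k.1) h1 continuousAt_fst
  unfold totalT
  exact h2.clm_apply (by fun_prop)

/-- The alternative `D_t T = D_x X = 0` is impossible, as the transformed `f` would not depend on
`u_x` although it would be inversely proportional to `f`. -/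
theorem totalT_x_eq_zero (h : Preserves Φ P Q) (hz : z ∈ Φ.source) :
    (totalT P z.1).2.1 = 0 := by
  by_contra hne
  have cross : ∀ {w : Ext}, w ∈ Φ.source → (totalT P w.1).2.1 ≠ 0 →
      (totalT P w.1).1 = 0 ∧ (totalX P w.1).2.1 = 0 := by
    intro w hw h0
    obtain ⟨h1, h2⟩ := h.products_eq_zero hw
    have h3 := (mul_eq_zero.1 h1).resolve_right h0
    have h4 := h.det_ne_zero hw
    rw [h3, zero_mul, zero_sub, neg_ne_zero] at h4
    exact ⟨h3, (mul_eq_zero.1 h2).resolve_left (right_ne_zero_of_mul h4)⟩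
  have hcont : ContinuousAt (fun k => (totalT P k).2.1) z.1 :=
    (h.continuousAt_totalT hz).snd.fst
  have hev : ∀ᶠ k in 𝓝 z.1, (totalT P k).2.1 ≠ 0 := hcont.eventually_ne hne
  -- moving along `u_t`, the vanishing of `D_t T` gives `T_u = 0`
  obtain ⟨a0, b0⟩ := cross hz hne
  have hTu : (fderiv ℝ P z.1.1 (0, 0, 1)).1 = 0 := by
    have e := eventually_line ((eventually_mem hz).and hev) (0, ((1 : ℝ), (0 : ℝ)))
    obtain ⟨s, ⟨hs, hs'⟩, hs0⟩ := ((e.filter_mono (nhdsWithin_le_nhds (s := {0}ᶜ))).and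
      self_mem_nhdsWithin).exists
    have h1 := (cross hs hs').1
    have h2 : totalT P (z.1 + s • (0, ((1 : ℝ), (0 : ℝ))))
        = totalT P z.1 + s • fderiv ℝ P z.1.1 (0, 0, 1) := by
      rw [← totalT_add]; simp [totalT]
    rw [h2] at h1
    simp only [Prod.fst_add, a0, Prod.smul_fst, smul_eq_mul, zero_add, mul_eq_zero] at h1
    exact h1.resolve_left hs0
  obtain ⟨F, G, hF, -, hFG⟩ := h.exists_image hz
  -- the transformed `f` does not change along `u_x`
  have hW : (fderiv ℝ Q z.1 (0, ((0 : ℝ), (1 : ℝ)))).args = 0 := by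
    have h1 := (h.fibre_derivative hz 0 1).1
    rw [a0] at h1
    simp only [mul_zero, zero_add, mul_eq_zero, hne, or_false] at h1
    refine Prod.ext ?_ h1
    simp [J1.args, h.fderiv_jet_fst hz]
  have d1 := h.hasDerivAt_comp_args_line hz (0, ((0 : ℝ), (1 : ℝ))) hF
  rw [hW, map_zero] at d1
  have d2 : HasDerivAt (fun s : ℝ => z.2.1 + s) 1 0 := (hasDerivAt_id (0 : ℝ)).const_add z.2.1
  have d3 := (d2.mul d1).const_mul ((totalX P z.1).1 ^ 2)
  have d4 : HasDerivAt (fun _ : ℝ => (totalT P z.1).2.1 ^ 2) 0 0 := hasDerivAt_const _ _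
  have d5 := d3.unique (d4.congr_of_eventuallyEq (by
    filter_upwards [eventually_line (hFG.and hev) (0, ((0 : ℝ), (1 : ℝ)))] with s ⟨⟨hs, hs1⟩, hs2⟩
    have tT : totalT P (z.1 + s • (0, ((0 : ℝ), (1 : ℝ)))) = totalT P z.1 := by simp [totalT]
    have tX : totalX P (z.1 + s • (0, ((0 : ℝ), (1 : ℝ))))
        = totalX P z.1 + s • fderiv ℝ P z.1.1 (0, 0, 1) := by
      rw [← totalX_add]; simp [totalX]
    have e1 := (h.relations hs).2
    have e2 := (cross hs hs2).2
    have e3 : (totalX P (z.1 + s • (0, ((0 : ℝ), (1 : ℝ))))).1 = (totalX P z.1).1 := by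
      rw [tX]; simp [hTu]
    rw [hs1] at e1
    simp only [e2, tT, e3, a0] at e1
    have e4 : (z.1 + s • (0, ((0 : ℝ), (1 : ℝ)))).2.2 - z.1.2.2 = s := by simp
    rw [e4] at e1
    simp only [Pi.mul_apply]
    linear_combination -e1))
  simp only [zero_smul, add_zero, one_mul, mul_zero, mul_eq_zero] at d5
  have hdet := h.det_ne_zero hz
  rw [a0, zero_mul, zero_sub, neg_ne_zero] at hdet
  have d6 := d5.resolve_left (pow_ne_zero 2 (right_ne_zero_of_mul hdet))
  have d7 := (h.relations hz).2
  have d8 : (Φ z).2.1 = F (Q z.1).args := by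
    have := hFG.self_of_nhds.2
    simp only [sub_self, add_zero] at this
    rw [show ((z.1, z.2.1, z.2.2) : Ext) = z from rfl] at this
    rw [this]
  rw [d8, d6, b0] at d7
  simp [hne] at d7

theorem totalT_t_ne_zero (h : Preserves Φ P Q) (hz : z ∈ Φ.source) : (totalT P z.1).1 ≠ 0 := by
  have := h.det_ne_zero hz
  rw [h.totalT_x_eq_zero hz, zero_mul, sub_zero] at this
  exact left_ne_zero_of_mul this

theorem totalX_x_ne_zero (h : Preserves Φ P Q) (hz : z ∈ Φ.source) :
    (totalX P z.1).2.1 ≠ 0 := by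
  have := h.det_ne_zero hz
  rw [h.totalT_x_eq_zero hz, zero_mul, sub_zero] at this
  exact right_ne_zero_of_mul this

theorem totalX_t_eq_zero (h : Preserves Φ P Q) (hz : z ∈ Φ.source) :
    (totalX P z.1).1 = 0 :=
  (mul_eq_zero.1 (h.products_eq_zero hz).2).resolve_right (h.totalX_x_ne_zero hz)

theorem fderiv_point_u (h : Preserves Φ P Q) (hz : z ∈ Φ.source) :
    (fderiv ℝ P z.1.1 (0, 0, 1)).1 = 0 ∧ (fderiv ℝ P z.1.1 (0, 0, 1)).2.1 = 0 := by
  constructor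
  · obtain ⟨s, hs, hs0⟩ := (((eventually_line (eventually_mem hz)
      (0, ((0 : ℝ), (1 : ℝ)))).filter_mono (nhdsWithin_le_nhds (s := {0}ᶜ))).and
      self_mem_nhdsWithin).exists
    have h1 := h.totalX_t_eq_zero hs
    have tX : totalX P (z.1 + s • (0, ((0 : ℝ), (1 : ℝ))))
        = totalX P z.1 + s • fderiv ℝ P z.1.1 (0, 0, 1) := by
      rw [← totalX_add]; simp [totalX]
    rw [tX] at h1
    simp only [Prod.fst_add, h.totalX_t_eq_zero hz, Prod.smul_fst, smul_eq_mul, zero_add,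
      mul_eq_zero] at h1
    exact h1.resolve_left hs0
  · obtain ⟨s, hs, hs0⟩ := (((eventually_line (eventually_mem hz)
      (0, ((1 : ℝ), (0 : ℝ)))).filter_mono (nhdsWithin_le_nhds (s := {0}ᶜ))).and
      self_mem_nhdsWithin).exists
    have h1 := h.totalT_x_eq_zero hs
    have tT : totalT P (z.1 + s • (0, ((1 : ℝ), (0 : ℝ))))
        = totalT P z.1 + s • fderiv ℝ P z.1.1 (0, 0, 1) := by
      rw [← totalT_add]; simp [totalT]
    rw [tT] at h1
    simp only [Prod.snd_add, Prod.fst_add, h.totalT_x_eq_zero hz, Prod.smul_snd, Prod.smul_fst,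
      smul_eq_mul, zero_add, mul_eq_zero] at h1
    exact h1.resolve_left hs0

/-- The new `t` and `x` depend only on the old `t` and `x`, respectively. -/
theorem fderiv_point (h : Preserves Φ P Q) (hz : z ∈ Φ.source) (v : J0) :
    (fderiv ℝ P z.1.1 v).1 = (totalT P z.1).1 * v.1 ∧
    (fderiv ℝ P z.1.1 v).2.1 = (totalX P z.1).2.1 * v.2.1 := by
  have hv : v = v.1 • (1, 0, z.1.2.1) + v.2.1 • (0, 1, z.1.2.2)
      + (v.2.2 - v.1 * z.1.2.1 - v.2.1 * z.1.2.2) • ((0, 0, 1) : J0) := by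
    refine Prod.ext ?_ (Prod.ext ?_ ?_) <;> simp
  have e : fderiv ℝ P z.1.1 v = v.1 • totalT P z.1 + v.2.1 • totalX P z.1
      + (v.2.2 - v.1 * z.1.2.1 - v.2.1 * z.1.2.2) • fderiv ℝ P z.1.1 (0, 0, 1) := by
    conv_lhs => rw [hv]
    simp only [map_add, map_smul]
    rfl
  obtain ⟨h1, h2⟩ := h.fderiv_point_u hz
  rw [e]
  simp [h1, h2, h.totalX_t_eq_zero hz, h.totalT_x_eq_zero hz, mul_comm]

theorem contactFactor_eq (h : Preserves Φ P Q) (hz : z ∈ Φ.source) :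
    contactFactor P Q z.1 = (fderiv ℝ P z.1.1 (0, 0, 1)).2.2 := by
  obtain ⟨h1, h2⟩ := h.fderiv_point_u hz
  simp [contactFactor, h1, h2]

theorem f_eq (h : Preserves Φ P Q) (hz : z ∈ Φ.source) :
    (Φ z).2.1 = (totalX P z.1).2.1 ^ 2 / (totalT P z.1).1 ^ 2 * z.2.1 := by
  have h1 := (h.relations hz).2
  rw [h.totalX_t_eq_zero hz, h.totalT_x_eq_zero hz] at h1
  have h2 := h.totalT_t_ne_zero hz
  field_simp
  linear_combination h1

end Preserves

/-! ### The normal form of equivalence transformations -/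

theorem eq_of_fderiv_eq_zero_along {E : Type*} [NormedAddCommGroup E] [NormedSpace ℝ E]
    {f : E → ℝ} {c : E} {r : ℝ} {x y : E} (hx : x ∈ Metric.ball c r) (hy : y ∈ Metric.ball c r)
    (hf : ∀ w ∈ Metric.ball c r, DifferentiableAt ℝ f w)
    (h0 : ∀ w ∈ Metric.ball c r, fderiv ℝ f w (y - x) = 0) : f y = f x := by
  have hm : ∀ s ∈ Icc (0 : ℝ) 1, x + s • (y - x) ∈ Metric.ball c r := fun s hs =>
    (convex_ball c r).add_smul_sub_mem hx hy hs
  have hd : ∀ s ∈ Icc (0 : ℝ) 1, HasDerivAt (fun s : ℝ => f (x + s • (y - x))) 0 s := by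
    intro s hs
    have h1 := (hf _ (hm s hs)).hasFDerivAt
    have h2 : HasDerivAt (fun s : ℝ => x + s • (y - x)) (y - x) s := by
      simpa using ((hasDerivAt_id s).smul_const (y - x)).const_add x
    simpa [h0 _ (hm s hs), Function.comp_def] using h1.comp_hasDerivAt s h2
  have := constant_of_derivWithin_zero (f := fun s : ℝ => f (x + s • (y - x))) (a := 0) (b := 1)
    (fun s hs => (hd s hs).differentiableAt.differentiableWithinAt) (fun s hs =>
      ((hd s (Ico_subset_Icc_self hs)).hasDerivWithinAt).derivWithin
        (uniqueDiffOn_Icc zero_lt_one s (Ico_subset_Icc_self hs))) 1 (by simp)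
  simpa using this

theorem eq_center_of_hasDerivAt_zero {f : ℝ → ℝ} {c r t : ℝ}
    (h0 : ∀ s ∈ Metric.ball c r, HasDerivAt f 0 s) (ht : t ∈ Metric.ball c r) : f t = f c := by
  refine eq_of_fderiv_eq_zero_along (Metric.mem_ball_self (Metric.pos_of_mem_ball ht)) ht
    (fun s hs => (h0 s hs).differentiableAt) fun s hs => ?_
  simp [(h0 s hs).hasFDerivAt.fderiv]

namespace Preserves

variable {Φ : OpenPartialHomeomorph Ext Ext} {P : J0 → J0} {Q : J1 → J1} {z : Ext}

/-- The derivatives, along the coordinate lines, of the relation `f' = (X_x / T_t) ^ 2 f`, in which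
`f'` is a function of the new `(x, u_x)`. -/
theorem second_order_relation (h : Preserves Φ P Q) (hz : z ∈ Φ.source) {α β : ℝ → ℝ}
    (hev : ∀ᶠ k in 𝓝 z.1, (totalT P k).1 = α k.1.1 ∧ (totalX P k).2.1 = β k.1.2.1)
    (hα : DifferentiableAt ℝ α z.1.1.1) :
    (fderiv ℝ Q z.1 ((0, 0, 1), (0, 0))).2.2 = 0 ∧
    (fderiv ℝ Q z.1 ((1, 0, 0), (0, 0))).2.2 * α z.1.1.1
      = -2 * z.2.1 * deriv α z.1.1.1 * (fderiv ℝ Q z.1 (0, (0, 1))).2.2 ∧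
    ((fderiv ℝ Q z.1 ((1, 0, 0), (0, 0))).2.2 = 0 →
      HasDerivAt (fun s : ℝ => (Φ (z.1 + s • ((1, 0, 0), (0, 0)), z.2)).2.2) 0 0) := by
  obtain ⟨F, G, hF, hG, hFG⟩ := h.exists_image hz
  have e0 := hev.self_of_nhds
  have hα0 : α z.1.1.1 ≠ 0 := e0.1 ▸ h.totalT_t_ne_zero hz
  have hβ0 : β z.1.1.2.1 ≠ 0 := e0.2 ▸ h.totalX_x_ne_zero hz
  -- along a line with fixed `x`, the new `x` does not change to first order
  have hargs : ∀ v : J1, v.1.2.1 = 0 → (fderiv ℝ Q z.1 v).args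
      = (fderiv ℝ Q z.1 v).2.2 • ((0, 1) : ℝ × ℝ) := fun v hv => by
    have := (h.fderiv_point hz v.1).2
    rw [hv, mul_zero, ← h.fderiv_jet_fst hz] at this
    simp [J1.args, this]
  have main : ∀ v : J1, v.1.2.1 = 0 → HasDerivAt
      (fun s : ℝ => β z.1.1.2.1 ^ 2 / α (z.1.1.1 + s * v.1.1) ^ 2 * (z.2.1 + s * v.2.2))
      ((fderiv ℝ Q z.1 v).2.2 * fderiv ℝ F (Q z.1).args (0, 1)) 0 := by
    intro v hv
    have d := h.hasDerivAt_comp_args_line hz v hF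
    rw [hargs v hv, map_smul, smul_eq_mul] at d
    refine d.congr_of_eventuallyEq ?_
    filter_upwards [eventually_line (hFG.and hev) v] with s ⟨⟨hs, hs1⟩, hs2, hs3⟩
    have e1 := h.f_eq hs
    simp only [hs1, hs2, hs3] at e1
    rw [e1]
    simp [hv]
  have hlin : ∀ c d : ℝ, HasDerivAt (fun s : ℝ => c + s * d) d 0 := fun c d => by
    simpa using ((hasDerivAt_id (0 : ℝ)).mul_const d).const_add c
  have mU := main ((0, 0, 1), (0, 0)) rfl
  have mP := main (0, (0, 1)) rfl
  have mT := main ((1, 0, 0), (0, 0)) rfl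
  have nU := mU.unique ((hasDerivAt_const (0 : ℝ) (β z.1.1.2.1 ^ 2 / α z.1.1.1 ^ 2 *
    z.2.1)).congr_of_eventuallyEq (Eventually.of_forall fun s => by simp))
  have nP := mP.unique (((hlin z.2.1 1).const_mul (β z.1.1.2.1 ^ 2 / α z.1.1.1 ^
    2)).congr_of_eventuallyEq (Eventually.of_forall fun s => by simp))
  have hFW : fderiv ℝ F (Q z.1).args (0, 1) ≠ 0 := by
    intro h0
    rw [h0, mul_zero] at nP
    have : β z.1.1.2.1 ^ 2 / α z.1.1.1 ^ 2 * 1 ≠ 0 := by positivity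
    exact this nP.symm
  have hα' : HasDerivAt (fun s : ℝ => α (z.1.1.1 + s * 1)) (deriv α z.1.1.1) 0 := by
    have : HasDerivAt α (deriv α z.1.1.1) (z.1.1.1 + 0 * 1) := by simpa using hα.hasDerivAt
    simpa [Function.comp_def] using this.comp (0 : ℝ) (hlin z.1.1.1 1)
  have nT := mT.unique ((((hasDerivAt_const (0 : ℝ) (β z.1.1.2.1 ^ 2)).div (hα'.pow 2)
    (by simpa using hα0)).mul_const z.2.1).congr_of_eventuallyEq
      (Eventually.of_forall fun s => by simp))
  refine ⟨(mul_eq_zero.1 nU).resolve_right hFW, ?_, fun h0 => ?_⟩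
  · refine mul_right_cancel₀ hFW ?_
    simp only [Pi.pow_apply, zero_mul, mul_one, add_zero, zero_sub, Nat.cast_ofNat] at nT
    calc _ = (fderiv ℝ Q z.1 ((1, 0, 0), (0, 0))).2.2 * fderiv ℝ F (Q z.1).args (0, 1)
          * α z.1.1.1 := by ring
      _ = -2 * z.2.1 * deriv α z.1.1.1 * (β z.1.1.2.1 ^ 2 / α z.1.1.1 ^ 2 * 1) := by
          rw [nT]; field_simp; ring
      _ = _ := by rw [← nP]; ring
  · have d := h.hasDerivAt_comp_args_line hz ((1, 0, 0), (0, 0)) hG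
    rw [hargs _ rfl, h0, zero_smul, map_zero] at d
    refine d.congr_of_eventuallyEq ?_
    filter_upwards [eventually_line hFG ((1, 0, 0), (0, 0))] with s ⟨hs, hs1⟩
    simp only [Prod.snd_add, Prod.smul_snd, smul_zero, add_zero, sub_self] at hs1
    rw [show z.2 = (z.2.1, z.2.2) from rfl, hs1]

/-- Comparing two values of `f` over the same jet, `T` is affine in `t` and the new `u_x` depends
only on `x` and `u_x`. -/
theorem second_order (h : Preserves Φ P Q) (hz : z ∈ Φ.source) {α β : ℝ → ℝ}
    (hev : ∀ᶠ k in 𝓝 z.1, (totalT P k).1 = α k.1.1 ∧ (totalX P k).2.1 = β k.1.2.1)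
    (hα : DifferentiableAt ℝ α z.1.1.1) :
    (∀ t u a : ℝ, (fderiv ℝ Q z.1 ((t, 0, u), (a, 0))).2.2 = 0) ∧ deriv α z.1.1.1 = 0 ∧
      HasDerivAt (fun s : ℝ => (Φ (z.1 + s • ((1, 0, 0), (0, 0)), z.2)).2.2) 0 0 := by
  obtain ⟨hU, hT, hG⟩ := h.second_order_relation hz hev hα
  have hev' := (eventually_mem_f hz).filter_mono (nhdsWithin_le_nhds (s := {0}ᶜ))
  obtain ⟨s, hs, hs0⟩ := (hev'.and self_mem_nhdsWithin).exists
  have hT' := (h.second_order_relation hs hev hα).2.1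
  have hWp : (fderiv ℝ Q z.1 (0, (0, 1))).2.2 ≠ 0 := by
    have := (h.fibre_derivative hz 0 1).2
    rw [h.totalX_t_eq_zero hz, mul_zero, zero_add, mul_one] at this
    exact left_ne_zero_of_mul (this.trans_ne (h.contactFactor_ne_zero hz))
  have hα' : deriv α z.1.1.1 = 0 := by
    have : s * (deriv α z.1.1.1 * (fderiv ℝ Q z.1 (0, (0, 1))).2.2) = 0 := by
      simp only at hT'
      linear_combination (hT' - hT) / 2
    exact (mul_eq_zero.1 ((mul_eq_zero.1 this).resolve_left hs0)).resolve_right hWp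
  have hα0 : α z.1.1.1 ≠ 0 := hev.self_of_nhds.1 ▸ h.totalT_t_ne_zero hz
  have hWt : (fderiv ℝ Q z.1 ((1, 0, 0), (0, 0))).2.2 = 0 := by
    rw [hα'] at hT
    simpa [hα0] using hT
  have hWa : (fderiv ℝ Q z.1 (0, (1, 0))).2.2 = 0 := by
    have := (h.fibre_derivative hz 1 0).2
    rw [h.totalX_t_eq_zero hz, mul_zero, zero_add, mul_zero] at this
    exact (mul_eq_zero.1 this).resolve_right (h.totalX_x_ne_zero hz)
  refine ⟨fun t u a => ?_, hα', hG hWt⟩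
  have e : (((t, 0, u), (a, 0)) : J1) = t • ((1, 0, 0), (0, 0)) + u • ((0, 0, 1), (0, 0))
      + a • (0, (1, 0)) := by
    simp
  rw [e]
  simp only [map_add, map_smul, Prod.snd_add, Prod.smul_snd, hWt, hU, hWa]
  simp

/-- Near any point of its domain, an equivalence transformation has the explicit form given by
some coefficients. -/
theorem exists_normalForm (h : Preserves Φ P Q) (hz : z ∈ Φ.source) :
    ∃ (c₀ c₁ c₂ c₃ c₄ : ℝ) (φ ψ : ℝ → ℝ), c₁ ≠ 0 ∧ c₂ ≠ 0 ∧ deriv φ z.1.1.2.1 ≠ 0 ∧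
      (∀ᶠ x in 𝓝 z.1.1.2.1, ContDiffAt ℝ ∞ φ x ∧ ContDiffAt ℝ ∞ ψ x) ∧
      ∀ᶠ w in 𝓝 z, Φ w = Coeffs.ext ⟨c₀, c₁, c₂, c₃, c₄, φ, deriv φ, deriv (deriv φ),
        ψ, deriv ψ, deriv (deriv ψ)⟩ w := by
  obtain ⟨r, hr, hball⟩ := Metric.isOpen_iff.1 Φ.open_source z hz
  obtain ⟨⟨⟨t₀, x₀, u₀⟩, a₀, p₀⟩, f₀, g₀⟩ := z
  have hsrc : ∀ {t x u a p f g : ℝ}, t ∈ Metric.ball t₀ r → x ∈ Metric.ball x₀ r →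
      u ∈ Metric.ball u₀ r → a ∈ Metric.ball a₀ r → p ∈ Metric.ball p₀ r →
      f ∈ Metric.ball f₀ r → g ∈ Metric.ball g₀ r → (((t, x, u), a, p), f, g) ∈ Φ.source := by
    intro t x u a p f g ht hx hu ha hp hf hg
    apply hball
    simp only [Metric.mem_ball, Prod.dist_eq, max_lt_iff] at *
    tauto
  have hself : ∀ c : ℝ, c ∈ Metric.ball c r := fun c => Metric.mem_ball_self hr
  have mem0 : ∀ {y : J0}, y ∈ Metric.ball (t₀, x₀, u₀) r ↔
      y.1 ∈ Metric.ball t₀ r ∧ y.2.1 ∈ Metric.ball x₀ r ∧ y.2.2 ∈ Metric.ball u₀ r := by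
    intro y
    simp only [Metric.mem_ball, Prod.dist_eq, max_lt_iff]
  have mem1 : ∀ {k : J1}, k ∈ Metric.ball ((t₀, x₀, u₀), a₀, p₀) r ↔
      k.1 ∈ Metric.ball (t₀, x₀, u₀) r ∧ k.2.1 ∈ Metric.ball a₀ r ∧ k.2.2 ∈ Metric.ball p₀ r := by
    intro k
    simp only [Metric.mem_ball, Prod.dist_eq, max_lt_iff]
  have hs1 : ∀ {k : J1}, k ∈ Metric.ball ((t₀, x₀, u₀), a₀, p₀) r →
      (k, f₀, g₀) ∈ Φ.source := by
    intro k hk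
    obtain ⟨h1, h2, h3⟩ := mem1.1 hk
    obtain ⟨h4, h5, h6⟩ := mem0.1 h1
    exact hsrc h4 h5 h6 h2 h3 (hself _) (hself _)
  have hs0 : ∀ {y : J0}, y ∈ Metric.ball (t₀, x₀, u₀) r →
      ((y, a₀, p₀), f₀, g₀) ∈ Φ.source := fun hy => hs1 (mem1.2 ⟨hy, hself _, hself _⟩)
  have hPs : ∀ {y : J0}, y ∈ Metric.ball (t₀, x₀, u₀) r → ContDiffAt ℝ ∞ P y := fun hy =>
    h.contDiffAt_point (hs0 hy)
  have hPd : ∀ {y : J0}, y ∈ Metric.ball (t₀, x₀, u₀) r → DifferentiableAt ℝ P y := fun hy =>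
    (hPs hy).differentiableAt (by simp)
  -- the components of `P` as functions of fewer variables
  set τ : ℝ → ℝ := fun t => (P (t, x₀, u₀)).1 with hτ
  set φ : ℝ → ℝ := fun x => (P (t₀, x, u₀)).2.1 with hφ
  set U : J0 → ℝ := fun y => (P y).2.2 with hU
  have m0 : ∀ {t x u : ℝ}, t ∈ Metric.ball t₀ r → x ∈ Metric.ball x₀ r → u ∈ Metric.ball u₀ r →
    ((t, x, u) : J0) ∈ Metric.ball (t₀, x₀, u₀) r := fun ht hx hu => mem0.2 ⟨ht, hx, hu⟩
  have hτs : ∀ t ∈ Metric.ball t₀ r, ContDiffAt ℝ ∞ τ t := fun t ht =>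
    (ContDiffAt.comp t (g := P) (f := fun t : ℝ => ((t, x₀, u₀) : J0))
      (hPs (m0 ht (hself _) (hself _))) (by fun_prop)).fst
  have hφs : ∀ x ∈ Metric.ball x₀ r, ContDiffAt ℝ ∞ φ x := fun x hx =>
    (ContDiffAt.comp x (g := P) (f := fun x : ℝ => ((t₀, x, u₀) : J0))
      (hPs (m0 (hself _) hx (hself _))) (by fun_prop)).snd.fst
  have hUs : ∀ y ∈ Metric.ball (t₀, x₀, u₀) r, ContDiffAt ℝ ∞ U y := fun y hy => (hPs hy).snd.snd
  have hPT : ∀ y ∈ Metric.ball (t₀, x₀, u₀) r, (P y).1 = τ y.1 := fun y hy => by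
    obtain ⟨h1, h2, h3⟩ := mem0.1 hy
    refine eq_of_fderiv_eq_zero_along (f := fun y => (P y).1) (m0 h1 (hself _) (hself _)) hy
      (fun w hw => (hPd hw).fst) fun w hw => ?_
    rw [((hPd hw).hasFDerivAt.fst).fderiv]
    have := (h.fderiv_point (hs0 hw) (y - (y.1, x₀, u₀))).1
    simpa using this
  have hPX : ∀ y ∈ Metric.ball (t₀, x₀, u₀) r, (P y).2.1 = φ y.2.1 := fun y hy => by
    obtain ⟨h1, h2, h3⟩ := mem0.1 hy
    refine eq_of_fderiv_eq_zero_along (f := fun y => (P y).2.1) (m0 (hself _) h2 (hself _)) hy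
      (fun w hw => (hPd hw).snd.fst) fun w hw => ?_
    rw [((hPd hw).hasFDerivAt.snd.fst).fderiv]
    have := (h.fderiv_point (hs0 hw) (y - (t₀, y.2.1, u₀))).2
    simpa using this
  have hline : ∀ {y : J0}, y ∈ Metric.ball (t₀, x₀, u₀) r → ∀ v : J0,
      HasDerivAt (fun s : ℝ => P (y + s • v)) (fderiv ℝ P y v) 0 := fun hy v =>
    (hPd hy).hasFDerivAt.hasLineDerivAt v
  have hlin : ∀ c d : ℝ, HasDerivAt (fun s : ℝ => c + s * d) d 0 := fun c d => by
    simpa using ((hasDerivAt_id (0 : ℝ)).mul_const d).const_add c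
  have hcomp : ∀ {f : ℝ → ℝ} {f' c : ℝ} (d : ℝ), HasDerivAt f f' c →
      HasDerivAt (fun s : ℝ => f (c + s * d)) (f' * d) 0 := fun {f f' c} d hf => by
    have : HasDerivAt f f' (c + 0 * d) := by simpa using hf
    exact this.comp (0 : ℝ) (hlin c d)
  have hdT : ∀ y ∈ Metric.ball (t₀, x₀, u₀) r, ∀ v : J0,
      (fderiv ℝ P y v).1 = deriv τ y.1 * v.1 := fun y hy v => by
    refine (HasDerivAt.prod_fst (hline hy v)).unique ?_
    refine (hcomp v.1 ((hτs _ (mem0.1 hy).1).differentiableAt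
      (by simp)).hasDerivAt).congr_of_eventuallyEq ?_
    filter_upwards [eventually_line (Metric.isOpen_ball.mem_nhds hy) v] with s hs
    rw [hPT _ hs]
    simp
  have hdX : ∀ y ∈ Metric.ball (t₀, x₀, u₀) r, ∀ v : J0,
      (fderiv ℝ P y v).2.1 = deriv φ y.2.1 * v.2.1 := fun y hy v => by
    refine (HasDerivAt.prod_fst (HasDerivAt.prod_snd (hline hy v))).unique ?_
    refine (hcomp v.2.1 ((hφs _ (mem0.1 hy).2.1).differentiableAt
      (by simp)).hasDerivAt).congr_of_eventuallyEq ?_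
    filter_upwards [eventually_line (Metric.isOpen_ball.mem_nhds hy) v] with s hs
    rw [hPX _ hs]
    simp
  have hdU : ∀ y ∈ Metric.ball (t₀, x₀, u₀) r, ∀ v : J0,
      (fderiv ℝ P y v).2.2 = fderiv ℝ U y v := fun y hy v => by
    rw [((hPd hy).hasFDerivAt.snd.snd).fderiv]
    rfl
  have htT : ∀ k ∈ Metric.ball ((t₀, x₀, u₀), a₀, p₀) r, (totalT P k).1 = deriv τ k.1.1 :=
    fun k hk => (hdT k.1 (mem1.1 hk).1 (1, 0, k.2.1)).trans (mul_one _)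
  have htX : ∀ k ∈ Metric.ball ((t₀, x₀, u₀), a₀, p₀) r, (totalX P k).2.1 = deriv φ k.1.2.1 :=
    fun k hk => (hdX k.1 (mem1.1 hk).1 (0, 1, k.2.2)).trans (mul_one _)
  have deriv_s : ∀ {f : ℝ → ℝ} {x : ℝ}, ContDiffAt ℝ ∞ f x → ContDiffAt ℝ ∞ (deriv f) x :=
    fun hf => hf.derivWithin (by simp)
  have deriv_d : ∀ {f : ℝ → ℝ} {x : ℝ}, ContDiffAt ℝ ∞ f x → HasDerivAt f (deriv f x) x :=
    fun hf => (hf.differentiableAt (by simp)).hasDerivAt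
  have second : ∀ {k : J1} {f g : ℝ}, k ∈ Metric.ball ((t₀, x₀, u₀), a₀, p₀) r →
      f ∈ Metric.ball f₀ r → g ∈ Metric.ball g₀ r →
      (∀ t u a : ℝ, (fderiv ℝ Q k ((t, 0, u), (a, 0))).2.2 = 0) ∧ deriv (deriv τ) k.1.1 = 0 ∧
      HasDerivAt (fun s : ℝ => (Φ (k + s • ((1, 0, 0), (0, 0)), f, g)).2.2) 0 0 := by
    intro k f g hk hf hg
    obtain ⟨h1, h2, h3⟩ := mem1.1 hk
    obtain ⟨h4, h5, h6⟩ := mem0.1 h1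
    refine h.second_order (z := (k, f, g)) (α := deriv τ) (β := deriv φ)
      (hsrc h4 h5 h6 h2 h3 hf hg) ?_ (deriv_d (deriv_s (hτs _ h4))).differentiableAt
    filter_upwards [Metric.isOpen_ball.mem_nhds hk] with k' hk'
    exact ⟨htT k' hk', htX k' hk'⟩
  have hτc : ∀ t ∈ Metric.ball t₀ r, deriv τ t = deriv τ t₀ := fun t ht => by
    refine eq_center_of_hasDerivAt_zero (r := r) (fun s hs => ?_) ht
    have := (second (k := ((s, x₀, u₀), a₀, p₀)) (mem1.2 ⟨m0 hs (hself _) (hself _), hself _,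
      hself _⟩) (hself f₀) (hself g₀)).2.1
    have h2 := deriv_d (deriv_s (hτs s hs))
    rwa [this] at h2
  -- the new `u_x` depends only on `x` and `u_x`
  have hW : ∀ k ∈ Metric.ball ((t₀, x₀, u₀), a₀, p₀) r,
      (Q k).2.2 = (Q ((t₀, k.1.2.1, u₀), a₀, k.2.2)).2.2 := fun k hk => by
    obtain ⟨h1, h2, h3⟩ := mem1.1 hk
    obtain ⟨h4, h5, h6⟩ := mem0.1 h1
    have hQd : ∀ w ∈ Metric.ball ((t₀, x₀, u₀), a₀, p₀) r, DifferentiableAt ℝ Q w := fun w hw =>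
      (h.contDiffAt_jet (hs1 hw)).differentiableAt (by simp)
    refine eq_of_fderiv_eq_zero_along (f := fun k => (Q k).2.2)
      (mem1.2 ⟨m0 (hself _) h5 (hself _), hself _, h3⟩) hk (fun w hw => (hQd w hw).snd.snd)
      fun w hw => ?_
    rw [((hQd w hw).hasFDerivAt.snd.snd).fderiv]
    have := (second hw (hself f₀) (hself g₀)).1 (k.1.1 - t₀) (k.1.2.2 - u₀) (k.2.1 - a₀)
    have e : k - ((t₀, k.1.2.1, u₀), a₀, k.2.2)
        = ((k.1.1 - t₀, 0, k.1.2.2 - u₀), (k.2.1 - a₀, 0)) := by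
      refine Prod.ext (Prod.ext rfl (Prod.ext ?_ rfl)) (Prod.ext rfl ?_) <;> simp
    rw [e]
    exact this
  have hsplit : ∀ y : J0, ∀ v : J0, fderiv ℝ U y v = v.1 * fderiv ℝ U y (1, 0, 0)
      + v.2.1 * fderiv ℝ U y (0, 1, 0) + v.2.2 * fderiv ℝ U y (0, 0, 1) := fun y v => by
    rw [← smul_eq_mul, ← smul_eq_mul, ← smul_eq_mul, ← map_smul, ← map_smul, ← map_smul,
      ← map_add, ← map_add]
    congr 1
    simp
  have hprx : ∀ k ∈ Metric.ball ((t₀, x₀, u₀), a₀, p₀) r,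
      fderiv ℝ U k.1 (0, 1, 0) + k.2.2 * fderiv ℝ U k.1 (0, 0, 1)
        = (Q k).2.2 * deriv φ k.1.2.1 := fun k hk => by
    have := h.prolong_x (hs1 hk)
    rw [h.totalX_t_eq_zero (hs1 hk), htX k hk, mul_zero, zero_add] at this
    rw [← this, totalX, hdU _ (mem1.1 hk).1, hsplit _ (0, 1, k.2.2)]
    simp
  have hprt : ∀ k ∈ Metric.ball ((t₀, x₀, u₀), a₀, p₀) r,
      fderiv ℝ U k.1 (1, 0, 0) + k.2.1 * fderiv ℝ U k.1 (0, 0, 1)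
        = (Q k).2.1 * deriv τ t₀ := fun k hk => by
    have := h.prolong_t (hs1 hk)
    rw [h.totalT_x_eq_zero (hs1 hk), htT k hk, mul_zero, add_zero,
      hτc _ (mem0.1 (mem1.1 hk).1).1] at this
    rw [← this, totalT, hdU _ (mem1.1 hk).1, hsplit _ (1, 0, k.2.1)]
    simp
  have hp₁ : p₀ + r / 2 ∈ Metric.ball p₀ r := by
    rw [Metric.mem_ball, Real.dist_eq, add_sub_cancel_left, abs_of_pos (by linarith)]
    linarith
  -- comparing two values of `u_x`, the derivatives `U_x` and `U_u` depend only on `x`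
  have hUxu : ∀ y ∈ Metric.ball (t₀, x₀, u₀) r,
      fderiv ℝ U y (0, 1, 0) = fderiv ℝ U (t₀, y.2.1, u₀) (0, 1, 0) ∧
      fderiv ℝ U y (0, 0, 1) = fderiv ℝ U (t₀, y.2.1, u₀) (0, 0, 1) := fun y hy => by
    have hy' := m0 (hself t₀) (mem0.1 hy).2.1 (hself u₀)
    have e : ∀ p ∈ Metric.ball p₀ r,
        fderiv ℝ U y (0, 1, 0) + p * fderiv ℝ U y (0, 0, 1)
          = fderiv ℝ U (t₀, y.2.1, u₀) (0, 1, 0)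
            + p * fderiv ℝ U (t₀, y.2.1, u₀) (0, 0, 1) := fun p hp => by
      have e1 := hprx (y, a₀, p) (mem1.2 ⟨hy, hself _, hp⟩)
      have e2 := hprx ((t₀, y.2.1, u₀), a₀, p) (mem1.2 ⟨hy', hself _, hp⟩)
      rw [hW (y, a₀, p) (mem1.2 ⟨hy, hself _, hp⟩)] at e1
      exact e1.trans e2.symm
    have e1 := e p₀ (hself _)
    have e2 := e _ hp₁
    have e3 : fderiv ℝ U y (0, 0, 1) = fderiv ℝ U (t₀, y.2.1, u₀) (0, 0, 1) := by
      have : r / 2 * (fderiv ℝ U y (0, 0, 1) - fderiv ℝ U (t₀, y.2.1, u₀) (0, 0, 1)) = 0 := by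
        linear_combination e2 - e1
      exact sub_eq_zero.1 ((mul_eq_zero.1 this).resolve_left (by positivity))
    rw [e3] at e1
    exact ⟨add_right_cancel e1, e3⟩
  have hUd : ∀ y ∈ Metric.ball (t₀, x₀, u₀) r, DifferentiableAt ℝ U y := fun y hy =>
    (hUs y hy).differentiableAt (by simp)
  have hUx : ∀ y ∈ Metric.ball (t₀, x₀, u₀) r,
      HasDerivAt (fun x => U (y.1, x, y.2.2)) (fderiv ℝ U y (0, 1, 0)) y.2.1 := fun y hy =>
    HasFDerivAt.comp_hasDerivAt (l := U) (f := fun x => ((y.1, x, y.2.2) : J0)) y.2.1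
      (hUd y hy).hasFDerivAt
      ((hasDerivAt_const _ _).prodMk ((hasDerivAt_id _).prodMk (hasDerivAt_const _ _)))
  have hUu : ∀ y ∈ Metric.ball (t₀, x₀, u₀) r,
      HasDerivAt (fun u => U (y.1, y.2.1, u)) (fderiv ℝ U y (0, 0, 1)) y.2.2 := fun y hy =>
    HasFDerivAt.comp_hasDerivAt (l := U) (f := fun u => ((y.1, y.2.1, u) : J0)) y.2.2
      (hUd y hy).hasFDerivAt
      ((hasDerivAt_const _ _).prodMk ((hasDerivAt_const _ _).prodMk (hasDerivAt_id _)))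
  have hUt : ∀ y ∈ Metric.ball (t₀, x₀, u₀) r,
      HasDerivAt (fun t => U (t, y.2.1, y.2.2)) (fderiv ℝ U y (1, 0, 0)) y.1 := fun y hy =>
    HasFDerivAt.comp_hasDerivAt (l := U) (f := fun t => ((t, y.2.1, y.2.2) : J0)) y.1
      (hUd y hy).hasFDerivAt
      ((hasDerivAt_id _).prodMk ((hasDerivAt_const _ _).prodMk (hasDerivAt_const _ _)))
  set c₂ : ℝ := fderiv ℝ U (t₀, x₀, u₀) (0, 0, 1) with hc₂
  have hUc : ∀ y ∈ Metric.ball (t₀, x₀, u₀) r, fderiv ℝ U y (0, 0, 1) = c₂ := fun y hy => by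
    obtain ⟨h1, h2, h3⟩ := mem0.1 hy
    rw [(hUxu y hy).2]
    -- `U (t₀, x, u) - U (t₀, x, u₀)` does not depend on `x`
    have e1 : ∀ u ∈ Metric.ball u₀ r, U (t₀, y.2.1, u) - U (t₀, y.2.1, u₀)
        = U (t₀, x₀, u) - U (t₀, x₀, u₀) := fun u hu => by
      refine eq_center_of_hasDerivAt_zero (r := r)
        (f := fun x => U (t₀, x, u) - U (t₀, x, u₀)) (fun x hx => ?_) h2
      have d := (hUx (t₀, x, u) (m0 (hself t₀) hx hu)).sub
        (hUx (t₀, x, u₀) (m0 (hself t₀) hx (hself u₀)))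
      rw [(hUxu (t₀, x, u) (m0 (hself t₀) hx hu)).1, sub_self] at d
      exact d
    have e2 := (hUu _ (m0 (hself t₀) h2 (hself u₀))).sub_const (U (t₀, y.2.1, u₀))
    have e3 := (hUu _ (m0 (hself t₀) (hself x₀) (hself u₀))).sub_const (U (t₀, x₀, u₀))
    refine e2.unique (e3.congr_of_eventuallyEq ?_)
    filter_upwards [Metric.isOpen_ball.mem_nhds (hself u₀)] with u hu using e1 u hu
  set ψ₀ : ℝ → ℝ := fun x => U (t₀, x, u₀) with hψ₀
  set χ : ℝ → ℝ := fun t => U (t, x₀, u₀) with hχ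
  have hψs : ∀ x ∈ Metric.ball x₀ r, ContDiffAt ℝ ∞ ψ₀ x := fun x hx =>
    ContDiffAt.comp x (g := U) (f := fun x : ℝ => ((t₀, x, u₀) : J0))
      (hUs _ (m0 (hself _) hx (hself _))) (by fun_prop)
  have hχs : ∀ t ∈ Metric.ball t₀ r, ContDiffAt ℝ ∞ χ t := fun t ht =>
    ContDiffAt.comp t (g := U) (f := fun t : ℝ => ((t, x₀, u₀) : J0))
      (hUs _ (m0 ht (hself _) (hself _))) (by fun_prop)
  have hψ' : ∀ x ∈ Metric.ball x₀ r, deriv ψ₀ x = fderiv ℝ U (t₀, x, u₀) (0, 1, 0) :=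
    fun x hx => (hUx _ (m0 (hself _) hx (hself _))).deriv
  have hUform : ∀ y ∈ Metric.ball (t₀, x₀, u₀) r,
      U y = c₂ * y.2.2 + χ y.1 + (ψ₀ y.2.1 - c₂ * u₀ - U (t₀, x₀, u₀)) := fun y hy => by
    obtain ⟨h1, h2, h3⟩ := mem0.1 hy
    have hR : ∀ w ∈ Metric.ball (t₀, x₀, u₀) r, HasFDerivAt
        (fun w : J0 => U w - c₂ * w.2.2 - ψ₀ w.2.1)
        (fderiv ℝ U w - c₂ • (ContinuousLinearMap.snd ℝ ℝ ℝ).comp (ContinuousLinearMap.snd ℝ ℝ _)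
          - (deriv ψ₀ w.2.1) • (ContinuousLinearMap.fst ℝ ℝ ℝ).comp
            (ContinuousLinearMap.snd ℝ ℝ _)) w := fun w hw => by
      refine ((hUd w hw).hasFDerivAt.sub ?_).sub ?_
      · exact ((hasFDerivAt_snd.comp w hasFDerivAt_snd).const_mul c₂)
      · exact (deriv_d (hψs _ (mem0.1 hw).2.1)).comp_hasFDerivAt w
          ((ContinuousLinearMap.fst ℝ ℝ ℝ).comp (ContinuousLinearMap.snd ℝ ℝ (ℝ × ℝ))).hasFDerivAt
    have := eq_of_fderiv_eq_zero_along (f := fun w : J0 => U w - c₂ * w.2.2 - ψ₀ w.2.1)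
      (m0 h1 (hself x₀) (hself u₀)) hy (fun w hw => (hR w hw).differentiableAt) fun w hw => by
        rw [(hR w hw).fderiv]
        simp only [sub_apply, smul_apply,
          ContinuousLinearMap.comp_apply, ContinuousLinearMap.coe_fst',
          ContinuousLinearMap.coe_snd', smul_eq_mul]
        rw [hsplit w, hUc w hw, (hUxu w hw).1, hψ' _ (mem0.1 hw).2.1]
        simp only [Prod.fst_sub, Prod.snd_sub]
        ring
    simp only at this
    linear_combination this
  have hUtχ : ∀ y ∈ Metric.ball (t₀, x₀, u₀) r, fderiv ℝ U y (1, 0, 0) = deriv χ y.1 :=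
    fun y hy => by
    obtain ⟨h1, h2, h3⟩ := mem0.1 hy
    refine (hUt y hy).unique ((((deriv_d (hχs _ h1)).const_add (c₂ * y.2.2)).add_const
      (ψ₀ y.2.1 - c₂ * u₀ - U (t₀, x₀, u₀))).congr_of_eventuallyEq ?_)
    filter_upwards [Metric.isOpen_ball.mem_nhds h1] with t ht using hUform _ (m0 ht h2 h3)
  have hc₁ : deriv τ t₀ ≠ 0 := by
    rw [← htT ((t₀, x₀, u₀), a₀, p₀) (mem1.2 ⟨Metric.mem_ball_self hr, hself _, hself _⟩)]
    exact h.totalT_t_ne_zero hz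
  have hφ0 : ∀ x ∈ Metric.ball x₀ r, deriv φ x ≠ 0 := fun x hx => by
    have hk : ((t₀, x, u₀), a₀, p₀) ∈ Metric.ball ((t₀, x₀, u₀), a₀, p₀) r :=
      mem1.2 ⟨m0 (hself _) hx (hself _), hself _, hself _⟩
    rw [← htX ((t₀, x, u₀), a₀, p₀) hk]
    exact h.totalX_x_ne_zero (hs1 hk)
  have hc₂0 : c₂ ≠ 0 := by
    have := h.contactFactor_ne_zero hz
    rwa [h.contactFactor_eq hz, hdU _ (Metric.mem_ball_self hr)] at this
  have hQV : ∀ k ∈ Metric.ball ((t₀, x₀, u₀), a₀, p₀) r,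
      (Q k).2.1 = (deriv χ k.1.1 + c₂ * k.2.1) / deriv τ t₀ := fun k hk => by
    have := hprt k hk
    rw [hUtχ _ (mem1.1 hk).1, hUc _ (mem1.1 hk).1] at this
    rw [eq_div_iff hc₁]
    linear_combination -this
  have hQW : ∀ k ∈ Metric.ball ((t₀, x₀, u₀), a₀, p₀) r,
      (Q k).2.2 = (c₂ * k.2.2 + deriv ψ₀ k.1.2.1) / deriv φ k.1.2.1 := fun k hk => by
    have := hprx k hk
    rw [(hUxu _ (mem1.1 hk).1).1, hUc _ (mem1.1 hk).1, ← hψ' _ (mem0.1 (mem1.1 hk).1).2.1] at this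
    rw [eq_div_iff (hφ0 _ (mem0.1 (mem1.1 hk).1).2.1)]
    linear_combination -this
  -- the transformation of `g`, read off from a single solution Hessian
  have hg : ∀ {k : J1} {f g : ℝ}, k ∈ Metric.ball ((t₀, x₀, u₀), a₀, p₀) r →
      f ∈ Metric.ball f₀ r → g ∈ Metric.ball g₀ r →
      (Φ (k, f, g)).2.2 = (c₂ * g + ((c₂ * k.2.2 + deriv ψ₀ k.1.2.1)
        * deriv (deriv φ) k.1.2.1 / deriv φ k.1.2.1 - deriv (deriv ψ₀) k.1.2.1) * f
          + deriv (deriv χ) k.1.1) / deriv τ t₀ ^ 2 := by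
    intro k f g hk hf hg
    obtain ⟨h1, h2, h3⟩ := mem1.1 hk
    obtain ⟨h4, h5, h6⟩ := mem0.1 h1
    have hs : (k, f, g) ∈ Φ.source := hsrc h4 h5 h6 h2 h3 hf hg
    obtain ⟨q', ⟨⟨e1, -⟩, -, e2⟩, e3⟩ := h.exists_hessian hs (g, 0, 0)
    have e3 := e3.1 (by simp)
    have hf' := h.f_eq hs
    simp only [htT k hk, htX k hk, hτc _ h4] at hf'
    simp only [h.fderiv_jet_fst hs, hdT _ h1, hdX _ h1, hτc _ h4] at e1 e2
    have hev : ∀ v : J1, ∀ᶠ s : ℝ in 𝓝 0, k + s • v ∈ Metric.ball ((t₀, x₀, u₀), a₀, p₀) r :=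
      fun v => eventually_line (Metric.isOpen_ball.mem_nhds hk) v
    have dV : (fderiv ℝ Q k ((1, 0, k.2.1), g, 0)).2.1
        = (deriv (deriv χ) k.1.1 * 1 + c₂ * g) / deriv τ t₀ := by
      refine (HasDerivAt.prod_fst (HasDerivAt.prod_snd (h.hasDerivAt_jet_line hs _))).unique
        ((((hcomp 1 (deriv_d (deriv_s (hχs _ h4)))).add
          ((hlin k.2.1 g).const_mul c₂)).div_const (deriv τ t₀)).congr_of_eventuallyEq ?_)
      filter_upwards [hev ((1, 0, k.2.1), g, 0)] with s hs'
      rw [hQV _ hs']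
      simp
    have dW : (fderiv ℝ Q k ((0, 1, k.2.2), 0, 0)).2.2
        = ((deriv (deriv ψ₀) k.1.2.1 * 1) * deriv φ k.1.2.1
          - (c₂ * k.2.2 + deriv ψ₀ k.1.2.1) * (deriv (deriv φ) k.1.2.1 * 1))
            / deriv φ k.1.2.1 ^ 2 := by
      have d1 := ((hcomp 1 (deriv_d (deriv_s (hψs _ h5)))).const_add (c₂ * k.2.2)).div
        (hcomp 1 (deriv_d (deriv_s (hφs _ h5)))) (by simpa using hφ0 _ h5)
      simp only [zero_mul, add_zero] at d1
      refine (HasDerivAt.prod_snd (HasDerivAt.prod_snd (h.hasDerivAt_jet_line hs _))).unique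
        (d1.congr_of_eventuallyEq ?_)
      filter_upwards [hev ((0, 1, k.2.2), 0, 0)] with s hs'
      rw [hQW _ hs']
      simp
    rw [dV] at e1
    rw [dW] at e2
    simp only [mul_one, mul_zero, add_zero, zero_add] at e1 e2
    have hφk := hφ0 _ h5
    have e4 : q'.1 = (deriv (deriv χ) k.1.1 + c₂ * g) / deriv τ t₀ / deriv τ t₀ := by
      rw [e1]; field_simp
    have e5 : q'.2.2 = (deriv (deriv ψ₀) k.1.2.1 * deriv φ k.1.2.1
          - (c₂ * k.2.2 + deriv ψ₀ k.1.2.1) * deriv (deriv φ) k.1.2.1)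
            / deriv φ k.1.2.1 ^ 2 / deriv φ k.1.2.1 := by
      rw [e2]; field_simp
    rw [e4, e5, hf'] at e3
    rw [← sub_eq_iff_eq_add'.2 e3]
    field_simp
    ring
  -- as `g'` does not depend on `t`, the function `χ` is quadratic
  have hχ3 : ∀ t ∈ Metric.ball t₀ r, HasDerivAt (deriv (deriv χ)) 0 t := fun t ht => by
    have hk : ((t, x₀, u₀), a₀, p₀) ∈ Metric.ball ((t₀, x₀, u₀), a₀, p₀) r :=
      mem1.2 ⟨m0 ht (hself _) (hself _), hself _, hself _⟩
    have d1 := (second hk (hself f₀) (hself g₀)).2.2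
    have d2 := ((hcomp 1 (deriv_d (deriv_s (deriv_s (hχs t ht))))).const_add
      (c₂ * g₀ + ((c₂ * p₀ + deriv ψ₀ x₀)
        * deriv (deriv φ) x₀ / deriv φ x₀ - deriv (deriv ψ₀) x₀) * f₀)).div_const (deriv τ t₀ ^ 2)
    have d3 := d1.unique (d2.congr_of_eventuallyEq (by
      filter_upwards [eventually_line (Metric.isOpen_ball.mem_nhds hk)
        ((1, 0, 0), 0, 0)] with s hs
      rw [hg hs (hself f₀) (hself g₀)]
      simp))
    have d4 : deriv (deriv (deriv χ)) t = 0 := by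
      rcases div_eq_zero_iff.1 d3.symm with h' | h'
      · simpa using h'
      · exact absurd h' (pow_ne_zero 2 hc₁)
    have := deriv_d (deriv_s (deriv_s (hχs t ht)))
    rwa [d4] at this
  set c₄ : ℝ := deriv (deriv χ) t₀ / 2 with hc₄
  have hχ2 : ∀ t ∈ Metric.ball t₀ r, deriv (deriv χ) t = 2 * c₄ := fun t ht => by
    rw [eq_center_of_hasDerivAt_zero hχ3 ht, hc₄]; ring
  set c₃ : ℝ := deriv χ t₀ - 2 * c₄ * t₀ with hc₃
  have hχ1 : ∀ t ∈ Metric.ball t₀ r, deriv χ t = 2 * c₄ * t + c₃ := fun t ht => by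
    have := eq_center_of_hasDerivAt_zero (f := fun t => deriv χ t - 2 * c₄ * t) (fun s hs => by
      have := (deriv_d (deriv_s (hχs s hs))).sub ((hasDerivAt_id s).const_mul (2 * c₄))
      rwa [hχ2 s hs, mul_one, sub_self] at this) ht
    linear_combination this
  have hχ0 : ∀ t ∈ Metric.ball t₀ r, χ t = c₄ * t ^ 2 + c₃ * t
      + (χ t₀ - c₄ * t₀ ^ 2 - c₃ * t₀) := fun t ht => by
    have := eq_center_of_hasDerivAt_zero (f := fun t => χ t - (c₄ * t ^ 2 + c₃ * t))
      (fun s hs => by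
        have := (deriv_d (hχs s hs)).sub ((((hasDerivAt_id s).pow 2).const_mul c₄).add
          ((hasDerivAt_id s).const_mul c₃))
        refine this.congr_deriv ?_
        rw [hχ1 s hs]
        simp
        ring) ht
    linear_combination this
  have hτ0 : ∀ t ∈ Metric.ball t₀ r, τ t = deriv τ t₀ * t + (τ t₀ - deriv τ t₀ * t₀) :=
    fun t ht => by
    have := eq_center_of_hasDerivAt_zero (f := fun t => τ t - deriv τ t₀ * t) (fun s hs => by
      have := (deriv_d (hτs s hs)).sub ((hasDerivAt_id s).const_mul (deriv τ t₀))
      rwa [hτc s hs, mul_one, sub_self] at this) ht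
    linear_combination this
  have hψadd : ∀ e : ℝ, deriv (fun x => ψ₀ x + e) = deriv ψ₀ := fun e => by
    funext x; simp
  refine ⟨τ t₀ - deriv τ t₀ * t₀, deriv τ t₀, c₂, c₃, c₄, φ,
    fun x => ψ₀ x + (χ t₀ - c₄ * t₀ ^ 2 - c₃ * t₀ - c₂ * u₀ - U (t₀, x₀, u₀)), hc₁, hc₂0,
    hφ0 _ (hself _), ?_, ?_⟩
  · filter_upwards [Metric.ball_mem_nhds _ hr] with x hx
    exact ⟨hφs _ hx, (hψs _ hx).add contDiffAt_const⟩
  filter_upwards [Metric.ball_mem_nhds _ hr] with w hw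
  obtain ⟨k, f, g⟩ := w
  have hw' : k ∈ Metric.ball ((t₀, x₀, u₀), a₀, p₀) r ∧ f ∈ Metric.ball f₀ r ∧
      g ∈ Metric.ball g₀ r := by
    simpa only [Metric.mem_ball, Prod.dist_eq, max_lt_iff] using hw
  obtain ⟨hk, hf, hg'⟩ := hw'
  obtain ⟨h1, h2, h3⟩ := mem1.1 hk
  obtain ⟨h4, h5, h6⟩ := mem0.1 h1
  have hs := hball hw
  rw [Coeffs.ext]
  refine Prod.ext ?_ (Prod.ext ?_ ?_)
  · rw [h.jet _ hs, Coeffs.jet]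
    refine Prod.ext ?_ (Prod.ext ?_ ?_)
    · rw [h.jet_fst hs, Coeffs.point]
      refine Prod.ext ?_ (Prod.ext ?_ ?_)
      · exact (hPT _ h1).trans (hτ0 _ h4)
      · exact hPX _ h1
      · refine (hUform _ h1).trans ?_
        rw [hχ0 _ h4]
        ring
    · refine (hQV k hk).trans ?_
      rw [hχ1 _ h4]
      simp only
      ring
    · refine (hQW k hk).trans ?_
      simp only [Coeffs.args, hψadd]
      rfl
  · rw [h.f_eq hs, htT k hk, htX k hk, hτc _ h4]
    rfl
  · rw [hg hk hf hg', hχ2 _ h4]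
    simp only [Coeffs.val, hψadd]
    rfl

end Preserves

/-! ### One-parameter groups and germs of diffeomorphisms of the line -/

/-- A smooth diffeomorphism `h` of the line with inverse `k`, together with the first two
derivatives `h₁` and `h₂` of `h`. -/
structure IsLineDiffeo (h k h₁ h₂ : ℝ → ℝ) : Prop where
  left_inv : ∀ x, k (h x) = x
  right_inv : ∀ x, h (k x) = x
  ne_zero : ∀ x, h₁ x ≠ 0
  hasDerivAt : ∀ x, HasDerivAt h (h₁ x) x
  hasDerivAt₁ : ∀ x, HasDerivAt h₁ (h₂ x) x
  smooth₂ : ContDiff ℝ ∞ h₂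
  smooth_inv : ContDiff ℝ ∞ k

theorem exists_contDiff_eventuallyEq {f : ℝ → ℝ} {x₀ : ℝ} (hf : ∀ᶠ x in 𝓝 x₀, ContDiffAt ℝ ∞ f x)
    {s : Set ℝ} (hs : s ∈ 𝓝 x₀) :
    ∃ m : ℝ → ℝ, ContDiff ℝ ∞ m ∧ HasCompactSupport m ∧ tsupport m ⊆ s ∧ m =ᶠ[𝓝 x₀] f := by
  obtain ⟨r, hr, hsub⟩ := Metric.nhds_basis_closedBall.mem_iff.1 (hf.and hs)
  let b : ContDiffBump x₀ := ⟨r / 2, r, by positivity, by linarith⟩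
  have htb : tsupport (fun x => b x * f x) ⊆ Metric.closedBall x₀ r :=
    (tsupport_mul_subset_left (f := b) (g := f)).trans b.tsupport_eq.subset
  refine ⟨fun x => b x * f x, ?_, b.hasCompactSupport.mul_right,
    fun x hx => (hsub (htb hx)).2, ?_⟩
  · rw [contDiff_iff_contDiffAt]
    intro x
    by_cases hx : x ∈ Metric.closedBall x₀ r
    · exact b.contDiffAt.mul (hsub hx).1
    · have : (fun x => b x * f x) =ᶠ[𝓝 x] 0 :=
        notMem_tsupport_iff_eventuallyEq.1 fun h => hx (htb h)
      exact contDiffAt_const.congr_of_eventuallyEq this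
  · filter_upwards [b.eventuallyEq_one] with x hx
    simp [hx]

theorem eventually_eq_of_hasDerivAt_zero {f : ℝ → ℝ} {c : ℝ}
    (h : ∀ᶠ x in 𝓝 c, HasDerivAt f 0 x) : ∀ᶠ x in 𝓝 c, f x = f c := by
  obtain ⟨r, hr, hb⟩ := Metric.eventually_nhds_iff_ball.1 h
  filter_upwards [Metric.ball_mem_nhds c hr] with x hx
  exact eq_center_of_hasDerivAt_zero hb hx

/-- A smooth positive function with positive lower bound is the derivative of a diffeomorphism of
the line. -/
theorem exists_isLineDiffeo {h₁ : ℝ → ℝ} {c : ℝ} (hs : ContDiff ℝ ∞ h₁) (hc : 0 < c)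
    (hb : ∀ x, c ≤ h₁ x) : ∃ h k : ℝ → ℝ, IsLineDiffeo h k h₁ (deriv h₁) := by
  have hd : ∀ x, HasDerivAt (fun x => ∫ t in (0 : ℝ)..x, h₁ t) (h₁ x) x := fun x =>
    (hs.continuous.integral_hasStrictDerivAt 0 x).hasDerivAt
  set h : ℝ → ℝ := fun x => ∫ t in (0 : ℝ)..x, h₁ t with hh
  have hmono : StrictMono h := strictMono_of_deriv_pos fun x => by
    rw [(hd x).deriv]; exact hc.trans_le (hb x)
  have hcont : Continuous h := continuous_iff_continuousAt.2 fun x => (hd x).continuousAt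
  have hlow : Monotone fun x => h x - c * x := by
    refine monotone_of_hasDerivAt_nonneg (f' := fun x => h₁ x - c) (fun x => ?_) fun x =>
      sub_nonneg.2 (hb x)
    exact ((hd x).sub ((hasDerivAt_id x).const_mul c)).congr_deriv (by rw [mul_one])
  have h0 : h 0 = 0 := by simp [hh]
  have htop : Tendsto h atTop atTop := by
    refine tendsto_atTop_mono' _ ?_ (tendsto_id.const_mul_atTop hc)
    filter_upwards [eventually_ge_atTop 0] with x hx
    have := hlow hx
    simp only [h0] at this
    simp only [id]
    linarith
  have hbot : Tendsto h atBot atBot := by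
    refine tendsto_atBot_mono' _ ?_ (tendsto_id.const_mul_atBot hc)
    filter_upwards [eventually_le_atBot 0] with x hx
    have := hlow hx
    simp only [h0] at this
    simp only [id]
    linarith
  have hsurj : Function.Surjective h := hcont.surjective htop hbot
  let e : ℝ ≃ₜ ℝ := (hmono.orderIsoOfSurjective h hsurj).toHomeomorph
  have he : ∀ x, e x = h x := fun x => rfl
  have hne : ∀ x, h₁ x ≠ 0 := fun x => (hc.trans_le (hb x)).ne'
  refine ⟨h, e.symm, fun x => e.symm_apply_apply x, fun x => e.apply_symm_apply x, hne, hd,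
    fun x => (hs.differentiable (by simp) x).hasDerivAt, (contDiff_infty_iff_deriv.1 hs).2, ?_⟩
  exact e.contDiff_symm_deriv hne hd (Coeffs.contDiff_of_hasDerivAt hd hs)

/-- An orientation-preserving germ of a diffeomorphism of the line that moves its base point
belongs to a one-parameter group: `h` straightens it if `h' = φ'` near the base point and `h' = 1`
near its image. -/
theorem exists_flow {φ : ℝ → ℝ} {x₀ : ℝ} (hφ : ∀ᶠ x in 𝓝 x₀, ContDiffAt ℝ ∞ φ x)
    (hpos : 0 < deriv φ x₀) (hne : φ x₀ ≠ x₀) :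
    ∃ h k h₁ h₂ : ℝ → ℝ, IsLineDiffeo h k h₁ h₂ ∧
      ∃ s : ℝ, ∀ᶠ x in 𝓝 x₀, φ x = k (h x + s) := by
  have hd : ∀ᶠ x in 𝓝 x₀, ContDiffAt ℝ ∞ (deriv φ) x :=
    hφ.mono fun x hx => hx.derivWithin (by simp)
  have hpos' : ∀ᶠ x in 𝓝 x₀, 0 < deriv φ x :=
    hd.self_of_nhds.continuousAt.eventually (lt_mem_nhds hpos)
  have hlog : ∀ᶠ x in 𝓝 x₀, ContDiffAt ℝ ∞ (fun x => Real.log (deriv φ x)) x := by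
    filter_upwards [hd, hpos'] with x h1 h2 using h1.log h2.ne'
  obtain ⟨m, hm, hmc, hms, hme⟩ := exists_contDiff_eventuallyEq hlog
    (isOpen_compl_singleton.mem_nhds hne.symm : {φ x₀}ᶜ ∈ 𝓝 x₀)
  obtain ⟨C, hC⟩ := hmc.exists_bound_of_continuous hm.continuous
  obtain ⟨h, k, hk⟩ := exists_isLineDiffeo (h₁ := fun x => Real.exp (m x)) hm.exp
    (Real.exp_pos (-C)) fun x => Real.exp_le_exp.2 (neg_le_of_abs_le (hC x))
  refine ⟨h, k, _, _, hk, h (φ x₀) - h x₀, ?_⟩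
  have h0 : m =ᶠ[𝓝 (φ x₀)] 0 := notMem_tsupport_iff_eventuallyEq.1 fun h => hms h rfl
  have e1 : ∀ᶠ y in 𝓝 (φ x₀), h y - y = h (φ x₀) - φ x₀ :=
    eventually_eq_of_hasDerivAt_zero (f := fun y => h y - y) <| by
      filter_upwards [h0] with y hy
      have := (hk.hasDerivAt y).sub (hasDerivAt_id y)
      exact this.congr_deriv (by simp [hy])
  have e2 : ∀ᶠ x in 𝓝 x₀, h x - φ x = h x₀ - φ x₀ :=
    eventually_eq_of_hasDerivAt_zero (f := fun x => h x - φ x) <| by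
      filter_upwards [hme, hpos', hφ] with x hx h1 h2
      have := (hk.hasDerivAt x).sub (h2.differentiableAt (by simp)).hasDerivAt
      simp only [hx, Real.exp_log h1, sub_self] at this
      exact this
  filter_upwards [e2, hφ.self_of_nhds.continuousAt.eventually e1] with x h2 h1
  rw [show h x + (h (φ x₀) - h x₀) = h (φ x) by linarith, hk.left_inv]

namespace Coeffs

/-- The coefficients of the identity. -/
def one : Coeffs where
  c₀ := 0
  c₁ := 1
  c₂ := 1
  c₃ := 0
  c₄ := 0
  φ x := x
  φ₁ _ := 1
  φ₂ _ := 0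
  ψ _ := 0
  ψ₁ _ := 0
  ψ₂ _ := 0

theorem isGlobal_one : one.IsGlobal fun x => x where
  c₁_ne := one_ne_zero
  c₂_ne := one_ne_zero
  φ₁_ne _ := one_ne_zero
  left_inv _ := rfl
  right_inv _ := rfl
  hasDerivAt_φ x := hasDerivAt_id x
  hasDerivAt_φ₁ x := hasDerivAt_const x 1
  hasDerivAt_ψ x := hasDerivAt_const x 0
  hasDerivAt_ψ₁ x := hasDerivAt_const x 0
  smooth_φ₂ := contDiff_const
  smooth_ψ₂ := contDiff_const
  smooth_χ := contDiff_id

/-- A family of global transformations that is a one-parameter group consists of continuous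
equivalence transformations. -/
theorem isContinuousEquivalence_of_family {p : ℝ → Coeffs} {χ : ℝ → ℝ → ℝ}
    (hg : ∀ s, (p s).IsGlobal (χ s)) (hs : ContDiff ℝ ∞ fun q : ℝ × Ext => (p q.1).ext q.2)
    (h0 : ∀ z, (p 0).ext z = z) (hadd : ∀ r s z, (p s).ext ((p r).ext z) = (p (s + r)).ext z)
    (s : ℝ) (z : Ext) : IsContinuousEquivalence (p s).ext z :=
  let γ : LocalOneParameterGroup :=
    { dom := univ
      map := fun s => (p s).ext
      isOpen_dom := isOpen_univ
      smooth := hs.contDiffOn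
      zero_mem := fun _ _ _ => mem_univ _
      interval := fun _ => by simpa using ordConnected_univ
      map_zero := fun z _ => h0 z
      neg_mem := fun _ _ _ => mem_univ _
      map_add := fun r s z _ _ _ => hadd r s z }
  IsContinuousEquivalence.of_group γ
    (fun s _ _ => ⟨_, (hg s).isEquivalenceTransformation, mem_univ _, EventuallyEq.rfl⟩) s z
    (mem_univ _)

/-- Scalings of `t` and `u` by `exp (a s)` and `exp (b s)`. -/
def scale (a b s : ℝ) : Coeffs := { one with c₁ := Real.exp (a * s), c₂ := Real.exp (b * s) }

theorem isContinuousEquivalence_scale (a b s : ℝ) (z : Ext) :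
    IsContinuousEquivalence (scale a b s).ext z := by
  refine isContinuousEquivalence_of_family (χ := fun _ x => x) (fun s => ?_) ?_ ?_ ?_ s z
  · exact { isGlobal_one with
      c₁_ne := (Real.exp_pos _).ne'
      c₂_ne := (Real.exp_pos _).ne' }
  · refine contDiff_ext_family ?_ ?_ ?_ ?_ ?_ ?_ ?_ ?_ ?_ ?_ ?_ (fun s => (Real.exp_pos _).ne')
      (fun s x => one_ne_zero) <;> dsimp only [scale, one] <;> fun_prop
  · intro z
    simp [ext, jet, point, args, val, scale, one, J1.args]
  · intro r s z
    have h1 := (Real.exp_pos (a * s)).ne'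
    have h2 := (Real.exp_pos (a * r)).ne'
    simp only [ext, jet, point, args, val, scale, one, J1.args, mul_add, Real.exp_add,
      Prod.mk.injEq]
    refine ⟨⟨⟨?_, ?_, ?_⟩, ?_, ?_⟩, ?_, ?_⟩ <;>
      first | trivial | ring1

/-- Translations of `t`. -/
def shiftT (s : ℝ) : Coeffs := { one with c₀ := s }

theorem isContinuousEquivalence_shiftT (s : ℝ) (z : Ext) :
    IsContinuousEquivalence (shiftT s).ext z := by
  refine isContinuousEquivalence_of_family (χ := fun _ x => x) (fun s => ?_) ?_ ?_ ?_ s z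
  · exact { isGlobal_one with }
  · refine contDiff_ext_family ?_ ?_ ?_ ?_ ?_ ?_ ?_ ?_ ?_ ?_ ?_ (fun s => one_ne_zero)
      (fun s x => one_ne_zero) <;> dsimp only [shiftT, one] <;> fun_prop
  · intro z
    simp [ext, jet, point, args, val, shiftT, one, J1.args]
  · intro r s z
    simp only [ext, jet, point, args, val, shiftT, one, J1.args, Prod.mk.injEq]
    refine ⟨⟨⟨?_, ?_, ?_⟩, ?_, ?_⟩, ?_, ?_⟩ <;> first | trivial | ring1

/-- The addition of `s (c₄ t ^ 2 + c₃ t + ψ x)` to `u`. -/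
def addU (c₃ c₄ : ℝ) (ψ : ℝ → ℝ) (s : ℝ) : Coeffs :=
  { one with
    c₃ := s * c₃
    c₄ := s * c₄
    ψ := fun x => s * ψ x
    ψ₁ := fun x => s * deriv ψ x
    ψ₂ := fun x => s * deriv (deriv ψ) x }

theorem isContinuousEquivalence_addU (c₃ c₄ : ℝ) {ψ : ℝ → ℝ} (hψ : ContDiff ℝ ∞ ψ) (s : ℝ)
    (z : Ext) : IsContinuousEquivalence (addU c₃ c₄ ψ s).ext z := by
  have h1 := (contDiff_infty_iff_deriv.1 hψ).2
  have h2 := (contDiff_infty_iff_deriv.1 h1).2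
  refine isContinuousEquivalence_of_family (χ := fun _ x => x) (fun s => ?_) ?_ ?_ ?_ s z
  · exact { isGlobal_one with
      hasDerivAt_ψ := fun x => (hψ.differentiable (by simp) x).hasDerivAt.const_mul s
      hasDerivAt_ψ₁ := fun x => (h1.differentiable (by simp) x).hasDerivAt.const_mul s
      smooth_ψ₂ := contDiff_const.mul h2 }
  · refine contDiff_ext_family ?_ ?_ ?_ ?_ ?_ ?_ ?_ ?_ ?_ ?_ ?_ (fun s => one_ne_zero)
      (fun s x => one_ne_zero) <;> dsimp only [addU, one] <;> fun_prop
  · intro z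
    simp [ext, jet, point, args, val, addU, one, J1.args]
  · intro r s z
    simp only [ext, jet, point, args, val, addU, one, J1.args, Prod.mk.injEq]
    refine ⟨⟨⟨?_, ?_, ?_⟩, ?_, ?_⟩, ?_, ?_⟩ <;> first | trivial | ring1

/-- The flow `x ↦ k (h x + s)`. -/
def flowX (h k h₁ h₂ : ℝ → ℝ) (s : ℝ) : Coeffs :=
  { one with
    φ := fun x => k (h x + s)
    φ₁ := fun x => h₁ x / h₁ (k (h x + s))
    φ₂ := fun x => (h₂ x - h₂ (k (h x + s)) * (h₁ x / h₁ (k (h x + s))) ^ 2)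
      / h₁ (k (h x + s)) }

theorem isGlobal_flowX {h k h₁ h₂ : ℝ → ℝ} (hl : IsLineDiffeo h k h₁ h₂) (s : ℝ) :
    (flowX h k h₁ h₂ s).IsGlobal fun y => k (h y - s) := by
  have hs1 := contDiff_of_hasDerivAt hl.hasDerivAt₁ hl.smooth₂
  have hs := contDiff_of_hasDerivAt hl.hasDerivAt hs1
  have h2 := hl.smooth₂
  have hk := hl.smooth_inv
  have hd : ∀ x, HasDerivAt (fun x => k (h x + s)) (h₁ x / h₁ (k (h x + s))) x := fun x => by
    have d1 : HasDerivAt k (h₁ (k (h x + s)))⁻¹ (h x + s) :=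
      HasDerivAt.of_local_left_inverse hk.continuous.continuousAt (hl.hasDerivAt _)
        (hl.ne_zero _) (Eventually.of_forall hl.right_inv)
    exact (d1.comp x ((hl.hasDerivAt x).add_const s)).congr_deriv (inv_mul_eq_div _ _)
  exact { isGlobal_one with
    φ₁_ne := fun x => div_ne_zero (hl.ne_zero _) (hl.ne_zero _)
    left_inv := fun x => by simp [flowX, hl.right_inv, hl.left_inv]
    right_inv := fun x => by simp [flowX, hl.right_inv, hl.left_inv]
    hasDerivAt_φ := hd
    hasDerivAt_φ₁ := fun x => by
      have e := hl.ne_zero (k (h x + s))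
      refine ((hl.hasDerivAt₁ x).div ((hl.hasDerivAt₁ (k (h x + s))).comp x (hd x))
        (hl.ne_zero _)).congr_deriv ?_
      simp only [flowX, Function.comp_apply]
      field_simp
    smooth_φ₂ := by
      dsimp only [flowX]
      fun_prop (disch := exact fun x => hl.ne_zero _)
    smooth_χ := by fun_prop }

theorem isContinuousEquivalence_flowX {h k h₁ h₂ : ℝ → ℝ} (hl : IsLineDiffeo h k h₁ h₂) (s : ℝ)
    (z : Ext) : IsContinuousEquivalence (flowX h k h₁ h₂ s).ext z := by
  have hs1 := contDiff_of_hasDerivAt hl.hasDerivAt₁ hl.smooth₂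
  have hs := contDiff_of_hasDerivAt hl.hasDerivAt hs1
  have h2 := hl.smooth₂
  have hk := hl.smooth_inv
  refine isContinuousEquivalence_of_family (isGlobal_flowX hl) ?_ ?_ ?_ s z
  · refine contDiff_ext_family ?_ ?_ ?_ ?_ ?_ ?_ ?_ ?_ ?_ ?_ ?_ (fun s => one_ne_zero)
      (fun s => (isGlobal_flowX hl s).φ₁_ne) <;> dsimp only [flowX, one] <;>
      fun_prop (disch := exact fun x => hl.ne_zero _)
  · intro z
    simp [ext, jet, point, args, val, flowX, one, J1.args, hl.left_inv, div_self (hl.ne_zero _)]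
  · intro r s z
    have e1 := hl.ne_zero z.1.1.2.1
    have e2 := hl.ne_zero (k (h z.1.1.2.1 + r))
    have e3 := hl.ne_zero (k (h z.1.1.2.1 + (s + r)))
    simp only [ext, jet, point, args, val, flowX, one, J1.args, hl.right_inv, add_assoc,
      add_comm r s, Prod.mk.injEq]
    refine ⟨⟨⟨?_, trivial, ?_⟩, ?_, ?_⟩, ?_, ?_⟩ <;>
      first | trivial | ring1 | (field_simp; done) | (field_simp; ring1)

end Coeffs

/-- Every germ of the explicit form with orientation-preserving components is a continuous
equivalence transformation. A translation is split off from `φ`, so that the remaining germ moves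
its base point and `exists_flow` applies. -/
theorem exists_isContinuousEquivalence {c₀ c₁ c₂ c₃ c₄ : ℝ} {φ ψ : ℝ → ℝ} {z : Ext}
    (hc₁ : 0 < c₁) (hc₂ : 0 < c₂) (hφ' : 0 < deriv φ z.1.1.2.1)
    (hs : ∀ᶠ x in 𝓝 z.1.1.2.1, ContDiffAt ℝ ∞ φ x ∧ ContDiffAt ℝ ∞ ψ x) :
    ∃ Ψ : Ext → Ext, IsContinuousEquivalence Ψ z ∧ ∀ᶠ w in 𝓝 z,
      Coeffs.ext ⟨c₀, c₁, c₂, c₃, c₄, φ, deriv φ, deriv (deriv φ), ψ, deriv ψ, deriv (deriv ψ)⟩ w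
        = Ψ w := by
  set x₀ := z.1.1.2.1 with hx₀
  set a := φ x₀ - 1 - x₀ with ha
  have hx : Tendsto (fun y => y - a) (𝓝 (x₀ + a)) (𝓝 x₀) := by
    have : ContinuousAt (fun y => y - a) (x₀ + a) := by fun_prop
    simpa [ContinuousAt] using this
  have hx' : Tendsto (fun x => x + a) (𝓝 x₀) (𝓝 (x₀ + a)) := by
    have : ContinuousAt (fun x => x + a) x₀ := by fun_prop
    exact this
  obtain ⟨h, k, h₁, h₂, hl, s, hflow⟩ := exists_flow (φ := fun y => φ (y - a)) (x₀ := x₀ + a)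
    (by
      filter_upwards [hx.eventually hs] with y hy
      exact ContDiffAt.comp y hy.1 (by fun_prop))
    (by rw [deriv_comp_sub_const]; simpa using hφ')
    (by simp only [add_sub_cancel_right, ha]; linarith)
  obtain ⟨η, hη, -, -, hηψ⟩ := exists_contDiff_eventuallyEq
    (f := fun x => ψ x / c₂) (hs.mono fun x hx => hx.2.div_const c₂) univ_mem
  set p := Coeffs.flowX h k h₁ h₂ s with hp
  have hg := Coeffs.isGlobal_flowX hl s
  have f0 : φ =ᶠ[𝓝 x₀] fun x => p.φ (x + a) := by
    filter_upwards [hx'.eventually hflow] with x hx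
    rw [add_sub_cancel_right] at hx
    exact hx
  have f1 : deriv φ =ᶠ[𝓝 x₀] fun x => p.φ₁ (x + a) := f0.deriv.trans <| Eventually.of_forall
    fun x => by rw [deriv_comp_add_const]; exact (hg.hasDerivAt_φ _).deriv
  have f2 : deriv (deriv φ) =ᶠ[𝓝 x₀] fun x => p.φ₂ (x + a) := f1.deriv.trans <|
    Eventually.of_forall fun x => by rw [deriv_comp_add_const]; exact (hg.hasDerivAt_φ₁ _).deriv
  have g1 : deriv η =ᶠ[𝓝 x₀] fun x => deriv ψ x / c₂ := hηψ.deriv.trans <| Eventually.of_forall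
    fun x => by simp
  have g2 : deriv (deriv η) =ᶠ[𝓝 x₀] fun x => deriv (deriv ψ) x / c₂ := g1.deriv.trans <|
    Eventually.of_forall fun x => by simp
  have hid : IsLineDiffeo (fun x => x) (fun x => x) (fun _ => 1) (fun _ => 0) :=
    ⟨fun _ => rfl, fun _ => rfl, fun _ => one_ne_zero, fun x => hasDerivAt_id x,
      fun x => hasDerivAt_const x 1, contDiff_const, contDiff_id⟩
  refine ⟨p.ext ∘ (Coeffs.flowX (fun x => x) (fun x => x) (fun _ => 1) (fun _ => 0) a).ext ∘
    (Coeffs.shiftT c₀).ext ∘ (Coeffs.scale (Real.log c₁) (Real.log c₂) 1).ext ∘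
      (Coeffs.addU (c₃ / c₂) (c₄ / c₂) η 1).ext, ?_, ?_⟩
  · exact ((((Coeffs.isContinuousEquivalence_addU _ _ hη 1 z).comp _ _ _
      (Coeffs.isContinuousEquivalence_scale _ _ 1 _)).comp _ _ _
      (Coeffs.isContinuousEquivalence_shiftT c₀ _)).comp _ _ _
      (Coeffs.isContinuousEquivalence_flowX hid a _)).comp _ _ _
      (Coeffs.isContinuousEquivalence_flowX hl s _)
  · have hw : Tendsto (fun w : Ext => w.1.1.2.1) (𝓝 z) (𝓝 x₀) := by
      have : ContinuousAt (fun w : Ext => w.1.1.2.1) z := by fun_prop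
      exact this
    filter_upwards [hw.eventually f0, hw.eventually f1, hw.eventually f2, hw.eventually hηψ,
      hw.eventually g1, hw.eventually g2] with w w0 w1 w2 w3 w4 w5
    have hne := hg.φ₁_ne (w.1.1.2.1 + a)
    rw [← hp] at hne
    have p0 : p.c₀ = 0 := rfl
    have p1 : p.c₁ = 1 := rfl
    have p2 : p.c₂ = 1 := rfl
    have p3 : p.c₃ = 0 := rfl
    have p4 : p.c₄ = 0 := rfl
    have p5 : ∀ x, p.ψ x = 0 := fun _ => rfl
    have p6 : ∀ x, p.ψ₁ x = 0 := fun _ => rfl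
    have p7 : ∀ x, p.ψ₂ x = 0 := fun _ => rfl
    simp only [Function.comp_apply, Coeffs.ext, Coeffs.jet, Coeffs.point, Coeffs.args, Coeffs.val,
      Coeffs.shiftT, Coeffs.scale, Coeffs.addU, Coeffs.flowX, Coeffs.one, J1.args, w0, w1, w2, w3,
      w4, w5, p0, p1, p2, p3, p4, p5, p6, p7, mul_one, Real.exp_log hc₁, Real.exp_log hc₂,
      Prod.mk.injEq]
    refine ⟨⟨⟨?_, ?_, ?_⟩, ?_, ?_⟩, ?_, ?_⟩ <;>
      first | trivial | ring1 | (field_simp; done) | (field_simp; ring1)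

/-! ### Orientation characters -/

/-- At `z`, the derivative of `Ψ` multiplies the `t`- and `x`-components of vectors by `a` and `b`,
respectively, and the `u`-component of vectors without `t`- and `x`-components by `c`. -/
structure HasScales (Ψ : Ext → Ext) (z : Ext) (a b c : ℝ) : Prop where
  differentiableAt : DifferentiableAt ℝ Ψ z
  t : ∀ v, (fderiv ℝ Ψ z v).1.1.1 = a * v.1.1.1
  x : ∀ v, (fderiv ℝ Ψ z v).1.1.2.1 = b * v.1.1.2.1
  u : ∀ v, v.1.1.1 = 0 → v.1.1.2.1 = 0 → (fderiv ℝ Ψ z v).1.1.2.2 = c * v.1.1.2.2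

namespace HasScales

theorem comp {Ψ₁ Ψ₂ : Ext → Ext} {z : Ext} {a₁ b₁ c₁ a₂ b₂ c₂ : ℝ}
    (h₂ : HasScales Ψ₂ (Ψ₁ z) a₂ b₂ c₂) (h₁ : HasScales Ψ₁ z a₁ b₁ c₁) :
    HasScales (Ψ₂ ∘ Ψ₁) z (a₂ * a₁) (b₂ * b₁) (c₂ * c₁) := by
  have e : ∀ v, fderiv ℝ (Ψ₂ ∘ Ψ₁) z v = fderiv ℝ Ψ₂ (Ψ₁ z) (fderiv ℝ Ψ₁ z v) := fun v => by
    rw [fderiv_comp z h₂.differentiableAt h₁.differentiableAt]; rfl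
  refine ⟨h₂.differentiableAt.comp z h₁.differentiableAt, fun v => ?_, fun v => ?_,
    fun v ht hx => ?_⟩
  · rw [e, h₂.t, h₁.t, mul_assoc]
  · rw [e, h₂.x, h₁.x, mul_assoc]
  · rw [e, h₂.u _ (by rw [h₁.t, ht, mul_zero]) (by rw [h₁.x, hx, mul_zero]), h₁.u v ht hx,
      mul_assoc]

theorem congr {Ψ₁ Ψ₂ : Ext → Ext} {z : Ext} {a b c : ℝ} (h : HasScales Ψ₁ z a b c)
    (he : Ψ₂ =ᶠ[𝓝 z] Ψ₁) : HasScales Ψ₂ z a b c := by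
  have e := he.fderiv_eq (𝕜 := ℝ)
  exact ⟨h.differentiableAt.congr_of_eventuallyEq he, by rw [e]; exact h.t, by rw [e]; exact h.x,
    by rw [e]; exact h.u⟩

variable {Ψ : Ext → Ext} {z : Ext} {a b c : ℝ}

theorem eq_t (h : HasScales Ψ z a b c) :
    a = (fderiv ℝ Ψ z (((1, 0, 0), 0, 0), 0, 0)).1.1.1 := by
  rw [h.t, mul_one]

theorem eq_x (h : HasScales Ψ z a b c) :
    b = (fderiv ℝ Ψ z (((0, 1, 0), 0, 0), 0, 0)).1.1.2.1 := by
  rw [h.x, mul_one]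

theorem eq_u (h : HasScales Ψ z a b c) :
    c = (fderiv ℝ Ψ z (((0, 0, 1), 0, 0), 0, 0)).1.1.2.2 := by
  rw [h.u _ rfl rfl, mul_one]

end HasScales

theorem IsEquivalenceTransformation.exists_preserves {Φ : OpenPartialHomeomorph Ext Ext}
    (h : IsEquivalenceTransformation Φ) : ∃ P Q, Preserves Φ P Q := by
  obtain ⟨P, Q, h1, h2, h3, h4⟩ := h.preserves
  exact ⟨P, Q, h.smooth, h.smooth_symm, h1, h2, h3, h4⟩

theorem IsEquivalenceTransformation.exists_hasScales {Φ : OpenPartialHomeomorph Ext Ext}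
    (h : IsEquivalenceTransformation Φ) {z : Ext} (hz : z ∈ Φ.source) :
    ∃ a b c : ℝ, a ≠ 0 ∧ b ≠ 0 ∧ c ≠ 0 ∧ HasScales Φ z a b c := by
  obtain ⟨P, Q, h⟩ := h.exists_preserves
  have e : ∀ v, (fderiv ℝ Φ z v).1.1 = fderiv ℝ P z.1.1 v.1.1 := fun v => by
    rw [h.fderiv_fst hz, h.fderiv_jet_fst hz]
  refine ⟨_, _, _, h.totalT_t_ne_zero hz, h.totalX_x_ne_zero hz, h.contactFactor_ne_zero hz,
    (h.contDiffAt hz).differentiableAt (by simp), fun v => ?_, fun v => ?_, fun v ht hx => ?_⟩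
  · rw [e, (h.fderiv_point hz _).1]
  · rw [e, (h.fderiv_point hz _).2]
  · have hv : v.1.1 = v.1.1.2.2 • ((0, 0, 1) : J0) := by
      refine Prod.ext ?_ (Prod.ext ?_ ?_) <;> simp [ht, hx]
    rw [e, h.contactFactor_eq hz, hv, map_smul]
    simp [mul_comm]

theorem pos_of_isPreconnected {X : Type*} [TopologicalSpace X] {s : Set X} (hs : IsPreconnected s)
    {f : X → ℝ} (hf : ContinuousOn f s) (h0 : ∀ x ∈ s, f x ≠ 0) {x y : X} (hx : x ∈ s)
    (hy : y ∈ s) (hpos : 0 < f x) : 0 < f y := by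
  by_contra hle
  obtain ⟨w, hw, hw0⟩ := hs.intermediate_value hy hx hf ⟨not_lt.1 hle, hpos.le⟩
  exact h0 w hw hw0

/-- Along a one-parameter group the scales are continuous, nonvanishing, and equal to `1` at the
parameter `0`; hence they are positive. -/
theorem LocalOneParameterGroup.hasScales_pos {γ : LocalOneParameterGroup}
    (hγ : γ.InEquivalenceGroup) {s : ℝ} {z : Ext} (hz : (s, z) ∈ γ.dom) :
    ∃ a b c : ℝ, 0 < a ∧ 0 < b ∧ 0 < c ∧ HasScales (γ.map s) z a b c := by
  have hsc : ∀ r, (r, z) ∈ γ.dom → ∃ a b c : ℝ, a ≠ 0 ∧ b ≠ 0 ∧ c ≠ 0 ∧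
      HasScales (γ.map r) z a b c := fun r hr => by
    obtain ⟨Φ, hΦ, hzΦ, he⟩ := hγ r z hr
    obtain ⟨a, b, c, ha, hb, hc, h⟩ := hΦ.exists_hasScales hzΦ
    exact ⟨a, b, c, ha, hb, hc, h.congr he⟩
  have hcont : ∀ v : Ext, ContinuousOn (fun r => fderiv ℝ (γ.map r) z v) {r | (r, z) ∈ γ.dom} := by
    intro v
    have h1 : ContinuousOn (fun r : ℝ => fderiv ℝ (fun p : ℝ × Ext => γ.map p.1 p.2) (r, z) (0, v))
        {r | (r, z) ∈ γ.dom} :=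
      ((γ.smooth.continuousOn_fderiv_of_isOpen γ.isOpen_dom (by simp)).comp
        (f := fun r : ℝ => ((r, z) : ℝ × Ext)) (by fun_prop) fun r hr => hr).clm_apply
          continuousOn_const
    refine h1.congr fun r hr => ?_
    have d1 := ((γ.smooth.contDiffAt (γ.isOpen_dom.mem_nhds hr)).differentiableAt
      (by simp)).hasFDerivAt
    have d2 : HasFDerivAt (fun w : Ext => ((r, w) : ℝ × Ext)) (ContinuousLinearMap.inr ℝ ℝ Ext) z :=
      hasFDerivAt_prodMk_right r z
    exact DFunLike.congr_fun (HasFDerivAt.comp z d1 d2).fderiv v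
  have h0mem := γ.zero_mem s z hz
  have hid : γ.map 0 =ᶠ[𝓝 z] id := by
    have hc : ContinuousAt (fun w : Ext => ((0, w) : ℝ × Ext)) z := by fun_prop
    filter_upwards [hc.eventually (γ.isOpen_dom.mem_nhds h0mem)] with w hw using γ.map_zero w hw
  have hfd0 : ∀ v, fderiv ℝ (γ.map 0) z v = v := fun v => by
    rw [hid.fderiv_eq, fderiv_id]; rfl
  have hpre : IsPreconnected {r | (r, z) ∈ γ.dom} := (γ.interval z).isPreconnected
  obtain ⟨a, b, c, -, -, -, h⟩ := hsc s hz
  refine ⟨a, b, c, ?_, ?_, ?_, h⟩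
  · rw [h.eq_t]
    refine pos_of_isPreconnected hpre (hcont (((1, 0, 0), 0, 0), 0, 0)).fst.fst.fst
      (fun r hr => ?_) h0mem hz (by simp [hfd0])
    obtain ⟨a, b, c, ha, -, -, h⟩ := hsc r hr
    exact h.eq_t ▸ ha
  · rw [h.eq_x]
    refine pos_of_isPreconnected hpre (hcont (((0, 1, 0), 0, 0), 0, 0)).fst.fst.snd.fst
      (fun r hr => ?_) h0mem hz (by simp [hfd0])
    obtain ⟨a, b, c, -, hb, -, h⟩ := hsc r hr
    exact h.eq_x ▸ hb
  · rw [h.eq_u]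
    refine pos_of_isPreconnected hpre (hcont (((0, 0, 1), 0, 0), 0, 0)).fst.fst.snd.snd
      (fun r hr => ?_) h0mem hz (by simp [hfd0])
    obtain ⟨a, b, c, -, -, hc, h⟩ := hsc r hr
    exact h.eq_u ▸ hc

theorem IsContinuousEquivalence.hasScales_pos {Ψ : Ext → Ext} {z : Ext}
    (h : IsContinuousEquivalence Ψ z) :
    ∃ a b c : ℝ, 0 < a ∧ 0 < b ∧ 0 < c ∧ HasScales Ψ z a b c := by
  induction h with
  | of_group γ hγ s z hz => exact γ.hasScales_pos hγ hz
  | comp Ψ₁ Ψ₂ z _ _ ih₁ ih₂ =>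
    obtain ⟨a₁, b₁, c₁, ha₁, hb₁, hc₁, h₁⟩ := ih₁
    obtain ⟨a₂, b₂, c₂, ha₂, hb₂, hc₂, h₂⟩ := ih₂
    exact ⟨_, _, _, mul_pos ha₂ ha₁, mul_pos hb₂ hb₁, mul_pos hc₂ hc₁, h₂.comp h₁⟩

/-- The sign `(-1) ^ e`. -/
def sgn (e : Fin 2) : ℝ := (-1) ^ (e : ℕ)

theorem sgn_eq (e : Fin 2) : (e = 0 ∧ sgn e = 1) ∨ (e = 1 ∧ sgn e = -1) := by
  fin_cases e <;> simp [sgn]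

theorem reflection_apply (ε : Fin 3 → Fin 2) (z : Ext) :
    reflection ε z = (((sgn (ε 0) * z.1.1.1, sgn (ε 1) * z.1.1.2.1, sgn (ε 2) * z.1.1.2.2),
      (sgn (ε 0) * sgn (ε 2) * z.1.2.1, sgn (ε 1) * sgn (ε 2) * z.1.2.2)),
        (z.2.1, sgn (ε 2) * z.2.2)) := by
  unfold reflection
  obtain ⟨⟨⟨t, x, u⟩, a, p⟩, f, g⟩ := z
  rcases sgn_eq (ε 0) with ⟨h0, -⟩ | ⟨h0, -⟩ <;> rcases sgn_eq (ε 1) with ⟨h1, -⟩ | ⟨h1, -⟩ <;>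
    rcases sgn_eq (ε 2) with ⟨h2, -⟩ | ⟨h2, -⟩ <;>
    simp [h0, h1, h2, sgn, reflectT, reflectX, reflectU]

theorem hasScales_reflection (ε : Fin 3 → Fin 2) (z : Ext) :
    HasScales (reflection ε) z (sgn (ε 0)) (sgn (ε 1)) (sgn (ε 2)) := by
  have hd : DifferentiableAt ℝ (reflection ε) z := by
    rw [funext (reflection_apply ε)]; fun_prop
  have key : ∀ v, fderiv ℝ (reflection ε) z v = reflection ε v := fun v => by
    refine fderiv_eq_of_hasDerivAt_line hd ?_
    have e : (fun s : ℝ => reflection ε (z + s • v))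
        = fun s : ℝ => reflection ε z + s • reflection ε v := by
      funext s
      simp only [reflection_apply]
      refine Prod.ext (Prod.ext (Prod.ext ?_ (Prod.ext ?_ ?_)) (Prod.ext ?_ ?_))
        (Prod.ext ?_ ?_) <;> simp <;> ring
    rw [e]
    simpa using ((hasDerivAt_id (0 : ℝ)).smul_const (reflection ε v)).const_add (reflection ε z)
  refine ⟨hd, fun v => ?_, fun v => ?_, fun v _ _ => ?_⟩ <;> rw [key, reflection_apply]

theorem eq_of_sgn_mul_pos {e e' : Fin 2} {a a' : ℝ} (ha : 0 < a) (ha' : 0 < a')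
    (h : sgn e * a = sgn e' * a') : e = e' := by
  rcases sgn_eq e with ⟨h1, h2⟩ | ⟨h1, h2⟩ <;> rcases sgn_eq e' with ⟨h3, h4⟩ | ⟨h3, h4⟩ <;>
    rw [h1, h3] <;> rw [h2, h4] at h <;> exfalso <;> linarith

/-- The exponents of the reflections are determined by the signs of the scales. -/
theorem DecomposesAt.unique {Φ : Ext → Ext} {ε ε' : Fin 3 → Fin 2} {z : Ext}
    (h : DecomposesAt Φ ε z) (h' : DecomposesAt Φ ε' z) : ε' = ε := by
  obtain ⟨Ψ, hΨ, he⟩ := h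
  obtain ⟨Ψ', hΨ', he'⟩ := h'
  obtain ⟨a, b, c, ha, hb, hc, hs⟩ := hΨ.hasScales_pos
  obtain ⟨a', b', c', ha', hb', hc', hs'⟩ := hΨ'.hasScales_pos
  have k := ((hasScales_reflection ε _).comp hs).congr he
  have k' := ((hasScales_reflection ε' _).comp hs').congr he'
  funext i
  fin_cases i
  · exact eq_of_sgn_mul_pos ha' ha (k'.eq_t.trans k.eq_t.symm)
  · exact eq_of_sgn_mul_pos hb' hb (k'.eq_x.trans k.eq_x.symm)
  · exact eq_of_sgn_mul_pos hc' hc (k'.eq_u.trans k.eq_u.symm)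

/-- The exponent with a given sign. -/
def exponent (a : ℝ) : Fin 2 := if 0 < a then 0 else 1

theorem sgn_exponent_mul_pos {a : ℝ} (ha : a ≠ 0) : 0 < sgn (exponent a) * a := by
  unfold exponent
  split_ifs with h
  · simpa [sgn] using h
  · simpa [sgn] using lt_of_le_of_ne (not_lt.1 h) ha

theorem exponent_eq_of_isPreconnected {X : Type*} [TopologicalSpace X] {s : Set X}
    (hs : IsPreconnected s) {f : X → ℝ} (hf : ContinuousOn f s) (h0 : ∀ x ∈ s, f x ≠ 0) {x y : X}
    (hx : x ∈ s) (hy : y ∈ s) : exponent (f x) = exponent (f y) := by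
  have : 0 < f x ↔ 0 < f y :=
    ⟨pos_of_isPreconnected hs hf h0 hx hy, pos_of_isPreconnected hs hf h0 hy hx⟩
  simp [exponent, this]

/-- Removing the reflections that correspond to the negative scales of the normal form leaves a
continuous equivalence transformation. -/
theorem IsEquivalenceTransformation.decomposesAt {Φ : OpenPartialHomeomorph Ext Ext}
    (h : IsEquivalenceTransformation Φ) {z : Ext} (hz : z ∈ Φ.source) {a b c : ℝ}
    (hsc : HasScales Φ z a b c) {ε : Fin 3 → Fin 2} (h₀ : 0 < sgn (ε 0) * a)
    (h₁ : 0 < sgn (ε 1) * b) (h₂ : 0 < sgn (ε 2) * c) : DecomposesAt Φ ε z := by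
  obtain ⟨P, Q, h⟩ := h.exists_preserves
  obtain ⟨c₀, c₁, c₂, c₃, c₄, φ, ψ, hc₁, hc₂, hφ, hsm, hform⟩ := h.exists_normalForm hz
  have line : ∀ v : Ext, HasDerivAt (fun s : ℝ => Φ (z + s • v)) (fderiv ℝ Φ z v) 0 := fun v =>
    hsc.differentiableAt.hasFDerivAt.hasLineDerivAt v
  have hlin : ∀ d : ℝ, HasDerivAt (fun s : ℝ => d + s) 1 0 := fun d =>
    (hasDerivAt_id (0 : ℝ)).const_add d
  have ea : a = c₁ := by
    rw [hsc.eq_t]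
    refine (HasDerivAt.prod_fst (HasDerivAt.prod_fst (HasDerivAt.prod_fst (line _)))).unique ?_
    refine ((((hlin z.1.1.1).const_mul c₁).add_const c₀).congr_deriv
      (mul_one _)).congr_of_eventuallyEq ?_
    filter_upwards [eventually_line hform (((1, 0, 0), 0, 0), 0, 0)] with s hs
    rw [hs]
    simp [Coeffs.ext, Coeffs.jet, Coeffs.point]
  have eb : b = deriv φ z.1.1.2.1 := by
    rw [hsc.eq_x]
    refine (HasDerivAt.prod_fst (HasDerivAt.prod_snd
      (HasDerivAt.prod_fst (HasDerivAt.prod_fst (line _))))).unique ?_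
    have d : HasDerivAt φ (deriv φ z.1.1.2.1) (z.1.1.2.1 + 0) := by
      rw [add_zero]; exact (hsm.self_of_nhds.1.differentiableAt (by simp)).hasDerivAt
    refine ((d.comp (0 : ℝ) (hlin z.1.1.2.1)).congr_deriv (mul_one _)).congr_of_eventuallyEq ?_
    filter_upwards [eventually_line hform (((0, 1, 0), 0, 0), 0, 0)] with s hs
    rw [hs]
    simp [Coeffs.ext, Coeffs.jet, Coeffs.point]
  have ec : c = c₂ := by
    rw [hsc.eq_u]
    refine (HasDerivAt.prod_snd (HasDerivAt.prod_snd
      (HasDerivAt.prod_fst (HasDerivAt.prod_fst (line _))))).unique ?_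
    refine ((((hlin z.1.1.2.2).const_mul c₂).add_const
      (c₄ * z.1.1.1 ^ 2 + c₃ * z.1.1.1 + ψ z.1.1.2.1)).congr_deriv
        (mul_one _)).congr_of_eventuallyEq ?_
    filter_upwards [eventually_line hform (((0, 0, 1), 0, 0), 0, 0)] with s hs
    rw [hs]
    simp [Coeffs.ext, Coeffs.jet, Coeffs.point, add_assoc]
  subst ea eb ec
  have dmul : ∀ (e : ℝ) (f : ℝ → ℝ), deriv (fun x => e * f x) = fun x => e * deriv f x :=
    fun e f => funext fun x => deriv_const_mul_field e
  obtain ⟨Ψ, hΨ, hev⟩ := exists_isContinuousEquivalence (c₀ := sgn (ε 0) * c₀)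
    (c₁ := sgn (ε 0) * a) (c₂ := sgn (ε 2) * c) (c₃ := sgn (ε 2) * c₃) (c₄ := sgn (ε 2) * c₄)
    (φ := fun x => sgn (ε 1) * φ x) (ψ := fun x => sgn (ε 2) * ψ x) (z := z) h₀ h₂
    (by rw [dmul]; exact h₁)
    (hsm.mono fun x hx => ⟨contDiffAt_const.mul hx.1, contDiffAt_const.mul hx.2⟩)
  refine ⟨Ψ, hΨ, ?_⟩
  filter_upwards [hform, hev] with w hw1 hw2
  rw [hw1, Function.comp_apply, ← hw2, reflection_apply]
  simp only [Coeffs.ext, Coeffs.jet, Coeffs.point, Coeffs.args, Coeffs.val, J1.args, dmul]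
  rcases sgn_eq (ε 0) with ⟨-, s0⟩ | ⟨-, s0⟩ <;> rcases sgn_eq (ε 1) with ⟨-, s1⟩ | ⟨-, s1⟩ <;>
    rcases sgn_eq (ε 2) with ⟨-, s2⟩ | ⟨-, s2⟩ <;> simp only [s0, s1, s2, Prod.mk.injEq] <;>
    refine ⟨⟨⟨?_, ?_, ?_⟩, ?_, ?_⟩, ?_, ?_⟩ <;> ring

end

end NonlinearWave

theorem mainTheorem3 :
    NonlinearWave.IsEquivalenceTransformation
      NonlinearWave.reflectT.toOpenPartialHomeomorph ∧
    NonlinearWave.IsEquivalenceTransformation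
      NonlinearWave.reflectX.toOpenPartialHomeomorph ∧
    NonlinearWave.IsEquivalenceTransformation
      NonlinearWave.reflectU.toOpenPartialHomeomorph ∧
    ∀ Φ : OpenPartialHomeomorph NonlinearWave.Ext NonlinearWave.Ext,
      NonlinearWave.IsEquivalenceTransformation Φ → IsPreconnected Φ.source →
      ∃ ε : Fin 3 → Fin 2,
        (∀ z ∈ Φ.source, NonlinearWave.DecomposesAt Φ ε z) ∧
        ∀ z ∈ Φ.source, ∀ ε' : Fin 3 → Fin 2,
          NonlinearWave.DecomposesAt Φ ε' z → ε' = ε := by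
  open NonlinearWave in
  refine ⟨isEquivalenceTransformation_reflection (a := -1) (b := 1) (c := 1) (by norm_num)
      (by norm_num) (by norm_num) reflectT_eq,
    isEquivalenceTransformation_reflection (a := 1) (b := -1) (c := 1) (by norm_num)
      (by norm_num) (by norm_num) reflectX_eq,
    isEquivalenceTransformation_reflection (a := 1) (b := 1) (c := -1) (by norm_num)
      (by norm_num) (by norm_num) reflectU_eq, fun Φ hΦ hconn => ?_⟩
  rcases Φ.source.eq_empty_or_nonempty with hempty | ⟨z₀, hz₀⟩
  · refine ⟨0, fun z hz => ?_, fun z hz => ?_⟩ <;> simp [hempty] at hz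
  have hcont : ∀ v : Ext, ContinuousOn (fun z => fderiv ℝ Φ z v) Φ.source := fun v =>
    (hΦ.smooth.continuousOn_fderiv_of_isOpen Φ.open_source (by simp)).clm_apply continuousOn_const
  -- the exponents are the signs of the scales at a base point, hence at every point
  have main : ∀ z ∈ Φ.source, DecomposesAt Φ
      ![exponent (fderiv ℝ Φ z₀ (((1, 0, 0), 0, 0), 0, 0)).1.1.1,
        exponent (fderiv ℝ Φ z₀ (((0, 1, 0), 0, 0), 0, 0)).1.1.2.1,
        exponent (fderiv ℝ Φ z₀ (((0, 0, 1), 0, 0), 0, 0)).1.1.2.2] z := fun z hz => by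
    obtain ⟨a, b, c, ha, hb, hc, h⟩ := hΦ.exists_hasScales hz
    refine hΦ.decomposesAt hz h ?_ ?_ ?_
    · change 0 < sgn (exponent _) * a
      rw [exponent_eq_of_isPreconnected hconn (hcont (((1, 0, 0), 0, 0), 0, 0)).fst.fst.fst
        (fun x hx => ?_) hz₀ hz, ← h.eq_t]
      · exact sgn_exponent_mul_pos ha
      · obtain ⟨a, b, c, ha, -, -, h⟩ := hΦ.exists_hasScales hx
        exact h.eq_t ▸ ha
    · change 0 < sgn (exponent _) * b
      rw [exponent_eq_of_isPreconnected hconn (hcont (((0, 1, 0), 0, 0), 0, 0)).fst.fst.snd.fst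
        (fun x hx => ?_) hz₀ hz, ← h.eq_x]
      · exact sgn_exponent_mul_pos hb
      · obtain ⟨a, b, c, -, hb, -, h⟩ := hΦ.exists_hasScales hx
        exact h.eq_x ▸ hb
    · change 0 < sgn (exponent _) * c
      rw [exponent_eq_of_isPreconnected hconn (hcont (((0, 0, 1), 0, 0), 0, 0)).fst.fst.snd.snd
        (fun x hx => ?_) hz₀ hz, ← h.eq_u]
      · exact sgn_exponent_mul_pos hc
      · obtain ⟨a, b, c, -, -, hc, h⟩ := hΦ.exists_hasScales hx
        exact h.eq_u ▸ hc
  exact ⟨_, main, fun z hz ε' h' => (main z hz).unique h'⟩
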